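/- Let $\mu:(0,\infty)\to[0,\infty)$ be non-increasing, integrable and absolutely continuous on compact subintervals of $(0,\infty)$ (possibly unbounded near $0$), such that $g(s)=\int_s^\infty\mu(r)\,dr$ satisfies $\int_0^\infty g(s)\,ds=1$. Assume that there are $C\ge 1$ and $\delta>0$ such that $$\mu(t+s)\le C e^{-\delta t}\mu(s)\qquad\text{for all } t\ge 0,\ s>0 .$$ Let $H^1_l(-1,0)=\{\varphi\in H^1(-1,0):\varphi(-1)=0\}$ and $H^1_r(0,1)=\{\varphi\in H^1(0,1):\varphi(1)=0\}$ with inner products $\langle\varphi,\psi\rangle=\langle\varphi',\psi'\rangle_{L^2}$, let $\mathcal M=L^2_\mu(0,\infty;H^1_r(0,1))$, and let $T\eta=-\eta_s$ on $\mathcal M$ with $D(T)=\{\eta\in\mathcal M:\eta_s\in\mathcal M,\ \lim_{s\to0}\|\eta(s)\|_{H^1_r(0,1)}=0\}$ (if $\mu$ vanishes beyond some point, derivatives in $s$ are taken on the interval $\{\mu>0\}$). On the complex Hilbert space $\mathcal H=H^1_l(-1,0)\times L^2(-1,0)\times L^2(0,1)\times\mathcal M$ let $\mathbb A(u,v,w,\eta)=(v,\,u'',\,\phi'',\,T\eta+w)$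 with $\phi=w+\int_0^\infty\mu(s)\eta(s)\,ds$, where $D(\mathbb A)$ consists of all $(u,v,w,\eta)\in\mathcal H$ with $u\in H^2(-1,0)$, $v\in H^1_l(-1,0)$, $w\in H^1_r(0,1)$, $\eta\in D(T)$, $\phi\in H^2(0,1)$, $u'(0)=\phi'(0)$ and $v(0)=w(0)$. Put $\Pi_\delta=\{\lambda\in\mathbb C:-\delta/2<\operatorname{Re}\lambda\le 0\}$ and, for $\lambda\in\Pi_\delta\setminus\{0\}$, $$\ell(\lambda)=1+\frac1\lambda\int_0^\infty\mu(s)\,(1-e^{-\lambda s})\,ds .$$ Let $Z_\ell=\{\lambda\in\Pi_\delta\setminus\{0\}:\ell(\lambda)=0\}$ and let $\Sigma$ be the set of all $\lambda\in\Pi_\delta\setminus(Z_\ell\cup\{0\})$ such that $$\sqrt{\ell(\lambda)\lambda}\,\sinh\lambda\,\cosh\sqrt{\tfrac{\lambda}{\ell(\lambda)}}+\cosh\lambda\,\sinh\sqrt{\tfrac{\lambda}{\ell(\lambda)}}=0 ,$$ where $\sqrt{\lambda/\ell(\lambda)}$ is the principal square root and $\sqrt{\ell(\lambda)\lambda}$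 denotes the square root $\ell(\lambda)\sqrt{\lambda/\ell(\lambda)}$ of $\ell(\lambda)\lambda$. Then $$\sigma(\mathbb A)\cap\Pi_\delta=\Sigma\cup Z_\ell .$$ -/

import Mathlib

open MeasureTheory Filter Topology Set
open scoped ContDiff ENNReal

noncomputable section

section Traces

variable {E : Type*} [NormedAddCommGroup E]

/-- `c` is the trace of `f` at the point `e` of the closure of `U`: the essential limit of
`f(s)` as `s → e`, `s ∈ U` (which, for a weakly differentiable `f`, is the limit of the
continuous representative of `f`). -/
def HasTrace (U : Set ℝ) (f : ℝ → E) (e : ℝ) (c : E) : Prop :=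
  Tendsto f (𝓝[U] e ⊓ ae volume) (𝓝 c)

theorem HasTrace.congr {U : Set ℝ} (hU : MeasurableSet U) {f g : ℝ → E} {e : ℝ} {c : E}
    (h : HasTrace U f e c) (hfg : f =ᵐ[volume.restrict U] g) : HasTrace U g e c := by
  refine Tendsto.congr' ?_ h
  have h1 : ∀ᵐ x, x ∈ U → f x = g x := (ae_restrict_iff' hU).1 hfg
  have h2 : ∀ᶠ x in 𝓝[U] e ⊓ ae volume, x ∈ U :=
    (eventually_mem_nhdsWithin).filter_mono inf_le_left
  filter_upwards [h2, h1.filter_mono inf_le_right] with x hx hx' using hx' hx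

theorem HasTrace.zero (U : Set ℝ) (e : ℝ) : HasTrace U (0 : ℝ → E) e 0 :=
  tendsto_const_nhds

theorem HasTrace.add {U : Set ℝ} {f g : ℝ → E} {e : ℝ} {c d : E}
    (hf : HasTrace U f e c) (hg : HasTrace U g e d) : HasTrace U (f + g) e (c + d) :=
  Tendsto.add hf hg

theorem HasTrace.smul {U : Set ℝ} {V : Type*} [NormedAddCommGroup V] [NormedSpace ℂ V]
    {f : ℝ → V} {e : ℝ} {c : V} (r : ℂ) (hf : HasTrace U f e c) :
    HasTrace U (r • f) e (r • c) :=
  Tendsto.const_smul hf r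

end Traces

section WeakDerivatives

variable {E : Type*} [NormedAddCommGroup E] [NormedSpace ℝ E]

/-- `f'` is the weak derivative of the (locally integrable) function `f` on the open set `U`
of the real line: `∫_U θ' f = - ∫_U θ f'` for every test function `θ ∈ C_c^∞(U)`. -/
def HasWeakDerivOn (U : Set ℝ) (f f' : ℝ → E) : Prop :=
  LocallyIntegrableOn f U ∧ LocallyIntegrableOn f' U ∧
    ∀ θ : ℝ → ℝ, ContDiff ℝ ∞ θ → HasCompactSupport θ → tsupport θ ⊆ U →
      ∫ s in U, deriv θ s • f s = - ∫ s in U, θ s • f' s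

theorem HasWeakDerivOn.congr {U : Set ℝ} {f f' g g' : ℝ → E}
    (h : HasWeakDerivOn U f f') (hfg : f =ᵐ[volume.restrict U] g)
    (hfg' : f' =ᵐ[volume.restrict U] g') : HasWeakDerivOn U g g' := by
  have key : ∀ {p q : ℝ → E}, LocallyIntegrableOn p U → p =ᵐ[volume.restrict U] q →
      LocallyIntegrableOn q U := by
    intro p q hp hpq x hx
    obtain ⟨s, hs, hps⟩ := hp x hx
    refine ⟨s ∩ U, inter_mem hs self_mem_nhdsWithin, ?_⟩
    refine (hps.mono_set inter_subset_left).congr ?_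
    exact ae_restrict_of_ae_restrict_of_subset inter_subset_right hpq
  refine ⟨key h.1 hfg, key h.2.1 hfg', fun θ h1 h2 h3 => ?_⟩
  have e1 : ∫ s in U, deriv θ s • g s = ∫ s in U, deriv θ s • f s :=
    integral_congr_ae (by filter_upwards [hfg] with x hx; rw [hx])
  have e2 : ∫ s in U, θ s • g' s = ∫ s in U, θ s • f' s :=
    integral_congr_ae (by filter_upwards [hfg'] with x hx; rw [hx])
  rw [e1, e2, h.2.2 θ h1 h2 h3]

theorem HasWeakDerivOn.zero (U : Set ℝ) : HasWeakDerivOn U (0 : ℝ → E) 0 := by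
  refine ⟨(locallyIntegrable_zero).locallyIntegrableOn U,
    (locallyIntegrable_zero).locallyIntegrableOn U, fun θ _ _ _ => by simp⟩

theorem integrableOn_test_smul {U : Set ℝ} {f : ℝ → E}
    (hf : LocallyIntegrableOn f U) {θ : ℝ → ℝ} (h1 : Continuous θ)
    (h2 : HasCompactSupport θ) (h3 : tsupport θ ⊆ U) :
    IntegrableOn (fun s => θ s • f s) U := by
  have hK : IsCompact (tsupport θ) := h2
  have i1 : IntegrableOn f (tsupport θ) := hf.integrableOn_compact_subset h3 hK
  have i2 : IntegrableOn (fun s => θ s • f s) (tsupport θ) :=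
    i1.continuousOn_smul h1.continuousOn hK
  have i3 : Integrable (fun s => θ s • f s) := by
    rw [← integrableOn_iff_integrable_of_support_subset (s := tsupport θ)]
    · exact i2
    · intro x hx
      apply subset_tsupport
      intro h0
      exact hx (by simp [h0])
  exact i3.integrableOn

theorem HasWeakDerivOn.add {U : Set ℝ} {f f' g g' : ℝ → E}
    (hf : HasWeakDerivOn U f f') (hg : HasWeakDerivOn U g g') :
    HasWeakDerivOn U (f + g) (f' + g') := by
  refine ⟨hf.1.add hg.1, hf.2.1.add hg.2.1, fun θ h1 h2 h3 => ?_⟩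
  have d1 : Continuous (deriv θ) := h1.continuous_deriv (by simp)
  have d2 : HasCompactSupport (deriv θ) := h2.deriv
  have d3 : tsupport (deriv θ) ⊆ U := (tsupport_deriv_subset (f := θ)).trans h3
  simp only [Pi.add_apply, smul_add]
  rw [integral_add (integrableOn_test_smul hf.1 d1 d2 d3)
    (integrableOn_test_smul hg.1 d1 d2 d3),
    integral_add (integrableOn_test_smul hf.2.1 h1.continuous h2 h3)
    (integrableOn_test_smul hg.2.1 h1.continuous h2 h3),
    hf.2.2 θ h1 h2 h3, hg.2.2 θ h1 h2 h3, neg_add]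

theorem HasWeakDerivOn.smul {U : Set ℝ} {V : Type*} [NormedAddCommGroup V] [NormedSpace ℂ V]
    {f f' : ℝ → V} (r : ℂ) (hf : HasWeakDerivOn U f f') :
    HasWeakDerivOn U (r • f) (r • f') := by
  refine ⟨hf.1.smul r, hf.2.1.smul r, fun θ h1 h2 h3 => ?_⟩
  simp only [Pi.smul_apply]
  have e1 : ∀ (a : ℝ) (v : V), a • r • v = r • a • v := fun a v => smul_comm a r v
  simp only [e1]
  rw [integral_smul, integral_smul, hf.2.2 θ h1 h2 h3, smul_neg]

/-- Weak derivatives are unique. -/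
theorem HasWeakDerivOn.ae_eq_zero [CompleteSpace E] {U : Set ℝ} (hU : IsOpen U) {f' : ℝ → E}
    (h : HasWeakDerivOn U 0 f') : f' =ᵐ[volume.restrict U] 0 := by
  have := hU.ae_eq_zero_of_integral_contDiff_smul_eq_zero (μ := volume) h.2.1
    (fun θ h1 h2 h3 => by
      have h4 := h.2.2 θ h1 h2 h3
      have h5 : ∫ x in U, θ x • f' x = ∫ x, θ x • f' x := by
        apply setIntegral_eq_integral_of_forall_compl_eq_zero
        intro x hx
        rw [image_eq_zero_of_notMem_tsupport (fun hx' => hx (h3 hx')), zero_smul]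
      rw [← h5]
      simpa using h4.symm)
  exact (ae_restrict_iff' hU.measurableSet).2 this

/-- A function with vanishing weak derivative on an interval is constant. -/
theorem HasWeakDerivOn.ae_const [CompleteSpace E] {a b : ℝ} (hab : a < b) {f : ℝ → E}
    (h : HasWeakDerivOn (Ioo a b) f 0) : ∃ c : E, f =ᵐ[volume.restrict (Ioo a b)] fun _ => c := by
  obtain ⟨m, hm⟩ : ∃ m, m = (a + b) / 2 := ⟨_, rfl⟩
  let ψb : ContDiffBump m := ⟨(b - a) / 8, (b - a) / 4, by linarith, by linarith⟩
  obtain ⟨ψ, hψ⟩ : ∃ ψ : ℝ → ℝ, ψ = ψb.normed volume := ⟨_, rfl⟩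
  have ψ1 : ContDiff ℝ ∞ ψ := hψ ▸ ψb.contDiff_normed
  have ψ2 : HasCompactSupport ψ := hψ ▸ ψb.hasCompactSupport_normed
  have ψ3 : tsupport ψ ⊆ Ioo a b := by
    rw [hψ, ψb.tsupport_normed_eq, Real.closedBall_eq_Icc]
    intro x hx
    have h1 : m - (b - a) / 4 ≤ x := hx.1
    have h2 : x ≤ m + (b - a) / 4 := hx.2
    constructor <;> linarith
  have ψ4 : ∫ x, ψ x = 1 := hψ ▸ ψb.integral_normed
  refine ⟨∫ x in Ioo a b, ψ x • f x, ?_⟩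
  set c := ∫ x in Ioo a b, ψ x • f x with hc
  have lc : LocallyIntegrableOn (fun _ : ℝ => c) (Ioo a b) :=
    (locallyIntegrable_const c).locallyIntegrableOn _
  have key := isOpen_Ioo.ae_eq_zero_of_integral_contDiff_smul_eq_zero (μ := volume)
    (U := Ioo a b) (f := fun x => f x - c) (h.1.sub lc) (fun θ h1 h2 h3 => by
      have h5 : ∫ x in Ioo a b, θ x • (f x - c) = ∫ x, θ x • (f x - c) := by
        apply setIntegral_eq_integral_of_forall_compl_eq_zero
        intro x hx
        rw [image_eq_zero_of_notMem_tsupport (fun hx' => hx (h3 hx')), zero_smul]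
      have h6 : ∫ x in Ioo a b, θ x = ∫ x, θ x := by
        apply setIntegral_eq_integral_of_forall_compl_eq_zero
        intro x hx
        rw [image_eq_zero_of_notMem_tsupport (fun hx' => hx (h3 hx'))]
      obtain ⟨I, hI⟩ : ∃ I, I = ∫ x, θ x := ⟨_, rfl⟩
      let g : ℝ → ℝ := fun x => θ x - I * ψ x
      have gs : ContDiff ℝ ∞ g := h1.sub (contDiff_const.mul ψ1)
      have gc : Continuous g := gs.continuous
      have hcs : HasCompactSupport g := h2.sub ψ2.mul_left
      obtain ⟨K, hK, hK1, hK2⟩ : ∃ K, IsCompact K ∧ K ⊆ Ioo a b ∧ ∀ x, x ∉ K → g x = 0 := by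
        refine ⟨tsupport θ ∪ tsupport ψ, IsCompact.union h2 ψ2, union_subset h3 ψ3, ?_⟩
        intro x hx
        simp only [mem_union, not_or] at hx
        simp only [g]
        rw [image_eq_zero_of_notMem_tsupport hx.1, image_eq_zero_of_notMem_tsupport hx.2]
        simp
      obtain ⟨p, q, hp, hq, hpq, hgpq⟩ : ∃ p q, a < p ∧ q < b ∧ p ≤ q ∧
          ∀ x, x ∉ Icc p q → g x = 0 := by
        rcases K.eq_empty_or_nonempty with hE | hN
        · refine ⟨m, m, by linarith, by linarith, le_rfl, fun x _ => hK2 x (by simp [hE])⟩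
        · obtain ⟨p, hp, hp'⟩ := hK.exists_isLeast hN
          obtain ⟨q, hq, hq'⟩ := hK.exists_isGreatest hN
          exact ⟨p, q, (hK1 hp).1, (hK1 hq).2, hp' hq,
            fun x hx => hK2 x (fun hxK => hx ⟨hp' hxK, hq' hxK⟩)⟩
      have iθ : Integrable θ := h1.continuous.integrable_of_hasCompactSupport h2
      have iψ : Integrable ψ := ψ1.continuous.integrable_of_hasCompactSupport ψ2
      have ig : Integrable g := gc.integrable_of_hasCompactSupport hcs
      have g0 : ∫ x, g x = 0 := by
        simp only [g]
        rw [integral_sub iθ (iψ.const_mul I), integral_const_mul, ψ4, ← hI]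
        ring
      let Θ : ℝ → ℝ := fun x => ∫ t in a..x, g t
      have Θd : ∀ x, HasDerivAt Θ (g x) x := fun x =>
        intervalIntegral.integral_hasDerivAt_right (gc.intervalIntegrable _ _)
          (gc.stronglyMeasurableAtFilter _ _) gc.continuousAt
      have Θd' : deriv Θ = g := funext fun x => (Θd x).deriv
      have Θs : ContDiff ℝ ∞ Θ :=
        contDiff_infty_iff_deriv.2 ⟨fun x => (Θd x).differentiableAt, Θd' ▸ gs⟩
      have Θ0 : ∀ x, x ∉ Icc p q → Θ x = 0 := by
        intro x hx
        rcases lt_or_ge x p with hx1 | hx1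
        · have : EqOn g (fun _ => 0) (uIcc a x) := by
            intro t ht
            apply hgpq
            intro ht'
            have : t ≤ max a x := ht.2
            have := ht'.1
            rcases le_max_iff.1 ‹t ≤ max a x› with h | h <;> linarith
          simp only [Θ]
          rw [intervalIntegral.integral_congr this]
          simp
        · have hx2 : q < x := by
            by_contra hcon
            exact hx ⟨hx1, not_lt.1 hcon⟩
          simp only [Θ]
          rw [← g0, intervalIntegral.integral_of_le (by linarith)]
          apply setIntegral_eq_integral_of_forall_compl_eq_zero
          intro t ht
          apply hgpq
          intro ht'
          exact ht ⟨by linarith [ht'.1], by linarith [ht'.2]⟩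
      have Θts : tsupport Θ ⊆ Icc p q := by
        apply closure_minimal _ isClosed_Icc
        intro x hx
        by_contra hcon
        exact hx (Θ0 x hcon)
      have Θcs : HasCompactSupport Θ := isCompact_Icc.of_isClosed_subset isClosed_closure Θts
      have e := h.2.2 Θ Θs Θcs
        (Θts.trans fun x hx => ⟨by linarith [hx.1], by linarith [hx.2]⟩)
      rw [Θd'] at e
      simp only [Pi.zero_apply, smul_zero, integral_zero, neg_zero, g, sub_smul, mul_smul] at e
      have j1 := integrableOn_test_smul h.1 h1.continuous h2 h3
      have j2 := integrableOn_test_smul h.1 ψ1.continuous ψ2 ψ3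
      have j3 : IntegrableOn (fun x => θ x • c) (Ioo a b) := (iθ.smul_const c).integrableOn
      have j2' : IntegrableOn (fun x => I • ψ x • f x) (Ioo a b) := j2.smul I
      rw [integral_sub j1 j2', integral_smul, ← hc, sub_eq_zero] at e
      rw [← h5]
      simp only [smul_sub]
      rw [integral_sub j1 j3, e, integral_smul_const, h6, ← hI, sub_self])
  refine (ae_restrict_iff' measurableSet_Ioo).2 ?_
  filter_upwards [key] with x hx hx'
  exact sub_eq_zero.1 (hx hx')

/-- Primitives are weakly differentiable. -/
theorem hasWeakDerivOn_primitive [CompleteSpace E] {a b : ℝ} (e : ℝ) {v : ℝ → E}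
    (hv : Integrable v) : HasWeakDerivOn (Ioo a b) (fun x => ∫ t in e..x, v t) v := by
  have hcont : Continuous fun x => ∫ t in e..x, v t :=
    intervalIntegral.continuous_primitive (fun _ _ => hv.intervalIntegrable) e
  refine ⟨hcont.locallyIntegrable.locallyIntegrableOn _,
    hv.locallyIntegrable.locallyIntegrableOn _, fun θ h1 h2 h3 => ?_⟩
  have hd : Continuous (deriv θ) := h1.continuous_deriv (by simp)
  have id : Integrable (deriv θ) := hd.integrable_of_hasCompactSupport h2.deriv
  have h3' : tsupport (deriv θ) ⊆ Ioo a b := (tsupport_deriv_subset (f := θ)).trans h3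
  rw [setIntegral_eq_integral_of_forall_compl_eq_zero (fun x hx => by
      rw [image_eq_zero_of_notMem_tsupport (fun hx' => hx (h3' hx')), zero_smul]),
    setIntegral_eq_integral_of_forall_compl_eq_zero (fun x hx => by
      rw [image_eq_zero_of_notMem_tsupport (fun hx' => hx (h3 hx')), zero_smul])]
  have hprim : ∀ x, ∫ t in e..x, v t = (∫ t in Iic x, v t) - ∫ t in Iic e, v t := fun x =>
    (intervalIntegral.integral_Iic_sub_Iic hv.integrableOn hv.integrableOn).symm
  have hIic : ∀ x, ∫ t in Iic x, v t = ∫ t, (Iic x).indicator v t := fun x =>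
    (integral_indicator measurableSet_Iic).symm
  have d0 : ∫ x, deriv θ x = 0 := integral_eq_zero_of_hasDerivAt_of_integrable
    (fun x => (h1.differentiable (by simp) x).hasDerivAt) id
    (h1.continuous.integrable_of_hasCompactSupport h2)
  let F : ℝ × ℝ → E := fun z => {z : ℝ × ℝ | z.2 ≤ z.1}.indicator
    (fun z => deriv θ z.1 • v z.2) z
  have iF : Integrable F (volume.prod volume) :=
    (id.smul_prod hv).indicator (measurableSet_le measurable_snd measurable_fst)
  have s1 : ∀ x, ∫ t, F (x, t) = deriv θ x • ∫ t in Iic x, v t := by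
    intro x
    rw [hIic, ← integral_smul]
    congr 1
    funext t
    by_cases h : t ≤ x <;> simp [F, indicator, h]
  have s2 : ∀ t, ∫ x, F (x, t) = - (θ t • v t) := by
    intro t
    have : ∀ x, F (x, t) = ((Ici t).indicator (deriv θ) x) • v t := by
      intro x
      by_cases h : t ≤ x <;> simp [F, indicator, h]
    simp only [this]
    rw [integral_smul_const, integral_indicator measurableSet_Ici, integral_Ici_eq_integral_Ioi,
      h2.integral_Ioi_deriv_eq (h1.of_le (by simp)), neg_smul]
  have i1 : Integrable fun x => deriv θ x • ∫ t in Iic x, v t := by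
    have := iF.integral_prod_left
    simpa only [s1] using this
  calc ∫ x, deriv θ x • ∫ t in e..x, v t
      = ∫ x, (deriv θ x • (∫ t in Iic x, v t) - deriv θ x • ∫ t in Iic e, v t) := by
        simp only [hprim, smul_sub]
    _ = ∫ x, deriv θ x • ∫ t in Iic x, v t := by
        rw [integral_sub i1 (id.smul_const _), integral_smul_const, d0, zero_smul, sub_zero]
    _ = ∫ x, ∫ t, F (x, t) := by simp only [s1]
    _ = ∫ t, ∫ x, F (x, t) := integral_integral_swap iF
    _ = - ∫ t, θ t • v t := by simp only [s2, integral_neg]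

end WeakDerivatives

section Sobolev

/-- The complex Hilbert space `L²(a,b)`. -/
abbrev L2 (a b : ℝ) : Type := Lp ℂ 2 (volume.restrict (Ioo a b))

/-- The pairs `(φ, φ')` with `φ ∈ H¹(a,b)`, weak derivative `φ'`, and `φ(e) = 0`. -/
def sobolevPairs (a b e : ℝ) : Submodule ℂ (L2 a b × L2 a b) where
  carrier := {p | HasWeakDerivOn (Ioo a b) p.1 p.2 ∧ HasTrace (Ioo a b) p.1 e 0}
  zero_mem' := by
    have h0 : (0 : ℝ → ℂ) =ᵐ[volume.restrict (Ioo a b)] (0 : L2 a b) := (Lp.coeFn_zero _ _ _).symm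
    exact ⟨(HasWeakDerivOn.zero _).congr h0 h0, (HasTrace.zero _ _).congr measurableSet_Ioo h0⟩
  add_mem' := by
    rintro p q ⟨hp1, hp2⟩ ⟨hq1, hq2⟩
    have h1 := (Lp.coeFn_add p.1 q.1).symm
    have h2 := (Lp.coeFn_add p.2 q.2).symm
    refine ⟨(hp1.add hq1).congr h1 h2, ?_⟩
    have := (hp2.add hq2).congr measurableSet_Ioo h1
    rwa [add_zero] at this
  smul_mem' := by
    rintro r p ⟨hp1, hp2⟩
    have h1 := (Lp.coeFn_smul r p.1).symm
    have h2 := (Lp.coeFn_smul r p.2).symm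
    refine ⟨(hp1.smul r).congr h1 h2, ?_⟩
    have := (hp2.smul r).congr measurableSet_Ioo h1
    rwa [smul_zero] at this

/-- The space `{φ ∈ H¹(a,b) : φ(e) = 0}`; an element is stored together with its (unique)
weak derivative. -/
def H1 (a b e : ℝ) : Type := ↥(sobolevPairs a b e)

instance (a b e : ℝ) : AddCommGroup (H1 a b e) := inferInstanceAs (AddCommGroup ↥(sobolevPairs a b e))

instance (a b e : ℝ) : Module ℂ (H1 a b e) := inferInstanceAs (Module ℂ ↥(sobolevPairs a b e))

/-- The function `φ ∈ L²(a,b)` underlying `φ ∈ H¹(a,b)`. -/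
def H1.toL2 {a b e : ℝ} : H1 a b e →ₗ[ℂ] L2 a b :=
  (LinearMap.fst ℂ (L2 a b) (L2 a b)).comp (sobolevPairs a b e).subtype

/-- The weak derivative `φ' ∈ L²(a,b)` of `φ ∈ H¹(a,b)`. -/
def H1.deriv {a b e : ℝ} : H1 a b e →ₗ[ℂ] L2 a b :=
  (LinearMap.snd ℂ (L2 a b) (L2 a b)).comp (sobolevPairs a b e).subtype

theorem H1.hasWeakDerivOn {a b e : ℝ} (φ : H1 a b e) :
    HasWeakDerivOn (Ioo a b) φ.toL2 φ.deriv := φ.2.1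

theorem H1.hasTrace {a b e : ℝ} (φ : H1 a b e) : HasTrace (Ioo a b) φ.toL2 e 0 := φ.2.2

theorem nhdsWithin_inf_ae_neBot {a b e : ℝ} (hab : a < b) (he : e ∈ Icc a b) :
    (𝓝[Ioo a b] e ⊓ ae (volume : Measure ℝ)).NeBot := by
  rw [inf_neBot_iff]
  intro s hs t ht
  obtain ⟨u, hu, hes, hus⟩ := mem_nhdsWithin.1 hs
  have hne : (u ∩ Ioo a b).Nonempty :=
    mem_closure_iff.1 (by rw [closure_Ioo hab.ne]; exact he) u hu hes
  have hpos : 0 < volume (u ∩ Ioo a b) := (hu.inter isOpen_Ioo).measure_pos _ hne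
  by_contra hcon
  have hsub : u ∩ Ioo a b ⊆ tᶜ := fun x hx hxt => hcon ⟨x, hus hx, hxt⟩
  have : volume (u ∩ Ioo a b) = 0 := measure_mono_null hsub ht
  exact hpos.ne' this

/-- The endpoint data `a < b`, `e ∈ [a,b]`. -/
class Endpoint (a b e : ℝ) : Prop where
  lt : a < b
  mem : e ∈ Icc a b

instance : Endpoint (-1) 0 (-1) := ⟨by norm_num, by norm_num⟩

instance : Endpoint 0 1 1 := ⟨by norm_num, by norm_num⟩

theorem H1.deriv_injective {a b e : ℝ} [h : Endpoint a b e] {φ : H1 a b e}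
    (h0 : φ.deriv = 0) : φ = 0 := by
  have h1 := φ.hasWeakDerivOn
  rw [h0] at h1
  obtain ⟨c, hc⟩ := (h1.congr (ae_eq_refl _) (Lp.coeFn_zero _ _ _)).ae_const h.lt
  have h2 := φ.hasTrace.congr measurableSet_Ioo hc
  have := nhdsWithin_inf_ae_neBot h.lt h.mem
  have hc0 : c = 0 := tendsto_nhds_unique tendsto_const_nhds h2
  subst hc0
  have h3 : φ.toL2 = 0 := Lp.ext (hc.trans (Lp.coeFn_zero _ _ _).symm)
  exact Subtype.ext (Prod.ext h3 h0)

theorem H1.deriv_surjective {a b e : ℝ} [Endpoint a b e] (v : L2 a b) :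
    ∃ φ : H1 a b e, φ.deriv = v := by
  let w : ℝ → ℂ := (Ioo a b).indicator v
  have hv : Integrable v (volume.restrict (Ioo a b)) :=
    (Lp.memLp v).integrable (by norm_num)
  have iw : Integrable w := (integrable_indicator_iff measurableSet_Ioo).2 hv
  have hw : w =ᵐ[volume.restrict (Ioo a b)] v := indicator_ae_eq_restrict measurableSet_Ioo
  let F : ℝ → ℂ := fun x => ∫ t in e..x, w t
  have hcont : Continuous F :=
    intervalIntegral.continuous_primitive (fun _ _ => iw.intervalIntegrable) e
  have hF : MemLp F 2 (volume.restrict (Ioo a b)) := by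
    obtain ⟨C, hC⟩ := isCompact_Icc.exists_bound_of_continuousOn (s := Icc a b) hcont.continuousOn
    refine MemLp.of_bound hcont.aestronglyMeasurable C ?_
    filter_upwards [ae_restrict_mem measurableSet_Ioo] with x hx using
      hC x (Ioo_subset_Icc_self hx)
  have hF' : F =ᵐ[volume.restrict (Ioo a b)] hF.toLp F := hF.coeFn_toLp.symm
  refine ⟨⟨(hF.toLp F, v), (hasWeakDerivOn_primitive e iw).congr hF' hw, ?_⟩, rfl⟩
  refine HasTrace.congr measurableSet_Ioo (f := F) ?_ hF'
  have : Tendsto F (𝓝 e) (𝓝 (F e)) := hcont.tendsto e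
  simp only [F, intervalIntegral.integral_same] at this
  exact this.mono_left (inf_le_left.trans nhdsWithin_le_nhds)

/-- The inner product `⟨φ, ψ⟩ = ⟨φ', ψ'⟩_{L²(a,b)}` (in Mathlib's convention, conjugate-linear in
the first variable). -/
instance H1.core (a b e : ℝ) [Endpoint a b e] : InnerProductSpace.Core ℂ (H1 a b e) where
  inner φ ψ := inner ℂ φ.deriv ψ.deriv
  conj_inner_symm φ ψ := inner_conj_symm _ _
  re_inner_nonneg φ := inner_self_nonneg
  add_left φ ψ χ := by simp only [map_add, inner_add_left]
  smul_left φ ψ r := by simp only [map_smul, inner_smul_left]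
  definite φ h := H1.deriv_injective (inner_self_eq_zero.1 h)

instance (a b e : ℝ) [Endpoint a b e] : NormedAddCommGroup (H1 a b e) :=
  (H1.core a b e).toNormedAddCommGroup

instance (a b e : ℝ) [Endpoint a b e] : InnerProductSpace ℂ (H1 a b e) :=
  InnerProductSpace.ofCore (H1.core a b e).toCore

theorem H1.inner_def {a b e : ℝ} [Endpoint a b e] (φ ψ : H1 a b e) :
    inner ℂ φ ψ = inner ℂ φ.deriv ψ.deriv := rfl

theorem H1.norm_deriv {a b e : ℝ} [Endpoint a b e] (φ : H1 a b e) : ‖φ.deriv‖ = ‖φ‖ := by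
  rw [@norm_eq_sqrt_re_inner ℂ, @norm_eq_sqrt_re_inner ℂ _ _ _ _ φ]
  rfl

/-- Differentiation is an isometric isomorphism of `{φ ∈ H¹(a,b) : φ(e) = 0}` onto `L²(a,b)`. -/
def H1.derivEquiv (a b e : ℝ) [Endpoint a b e] : H1 a b e ≃ₗᵢ[ℂ] L2 a b where
  toLinearEquiv := LinearEquiv.ofBijective H1.deriv
    ⟨(injective_iff_map_eq_zero _).2 fun _ => H1.deriv_injective, H1.deriv_surjective⟩
  norm_map' := H1.norm_deriv

instance (a b e : ℝ) [Endpoint a b e] : CompleteSpace (H1 a b e) :=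
  (H1.derivEquiv a b e).toIsometryEquiv.completeSpace

/-- `H¹_l(-1,0) = {φ ∈ H¹(-1,0) : φ(-1) = 0}`. -/
abbrev H1l : Type := H1 (-1) 0 (-1)

/-- `H¹_r(0,1) = {φ ∈ H¹(0,1) : φ(1) = 0}`. -/
abbrev H1r : Type := H1 0 1 1

end Sobolev

section Memory

/-- A memory kernel: a non-negative, non-increasing, (locally) absolutely continuous integrable
function `μ` on `(0,∞)`, possibly unbounded near zero, such that `g(s) = ∫_s^∞ μ(r) dr` has unit
total mass. -/
structure MemoryKernel where
  /-- the function `μ`; only its values on `(0,∞)` matter -/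
  μ : ℝ → ℝ
  nonneg : ∀ s, 0 < s → 0 ≤ μ s
  antitoneOn : AntitoneOn μ (Ioi 0)
  absolutelyContinuous : ∀ p q : ℝ, 0 < p → p ≤ q → AbsolutelyContinuousOnInterval μ p q
  integrableOn : IntegrableOn μ (Ioi 0)
  unit_mass : ∫ s in Ioi (0 : ℝ), ∫ r in Ioi s, μ r = 1

/-- The measure `μ(s) ds` on `(0,∞)`. -/
def MemoryKernel.measure (K : MemoryKernel) : Measure ℝ :=
  (volume.restrict (Ioi 0)).withDensity fun s => ENNReal.ofReal (K.μ s)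

instance (K : MemoryKernel) : IsFiniteMeasure K.measure :=
  isFiniteMeasure_withDensity_ofReal K.integrableOn.2

/-- The part `{s > 0 : μ(s) > 0}` of the half-line on which elements of the memory space are
determined; it is an interval `(0, s_∞)` with `0 < s_∞ ≤ ∞`. -/
def MemoryKernel.support (K : MemoryKernel) : Set ℝ := {s | 0 < s ∧ 0 < K.μ s}

theorem MemoryKernel.isOpen_support (K : MemoryKernel) : IsOpen K.support := by
  have hc : ContinuousOn K.μ (Ioi 0) := by
    intro x hx
    have hx' : (0 : ℝ) < x := hx
    have h1 := (K.absolutelyContinuous (x / 2) (2 * x) (by linarith) (by linarith)).continuousOn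
    rw [uIcc_of_le (by linarith)] at h1
    exact (h1.continuousAt (Icc_mem_nhds (by linarith) (by linarith))).continuousWithinAt
  exact hc.isOpen_inter_preimage isOpen_Ioi isOpen_Ioi

theorem MemoryKernel.ae_iff (K : MemoryKernel) {p : ℝ → Prop} :
    (∀ᵐ s ∂K.measure, p s) ↔ ∀ᵐ s ∂volume.restrict K.support, p s := by
  rw [MemoryKernel.measure, ae_withDensity_iff' K.integrableOn.1.aemeasurable.ennreal_ofReal,
    ae_restrict_iff' measurableSet_Ioi, ae_restrict_iff' K.isOpen_support.measurableSet]
  refine eventually_congr (Eventually.of_forall fun s => ?_)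
  simp only [ne_eq, ENNReal.ofReal_eq_zero, not_le, mem_Ioi, MemoryKernel.support, mem_ofPred_eq,
    and_imp]

/-- The memory space `L²_μ(0,∞; H¹_r(0,1))`. -/
abbrev Memory (K : MemoryKernel) : Type := Lp H1r 2 K.measure

end Memory

section SystemOperator

/-- The graph of `T η = -η_s`, with domain `D(T) = {η ∈ M : η_s ∈ M, lim_{s → 0} η(s) = 0}`. -/
def translationGraph (K : MemoryKernel) : Submodule ℂ (Memory K × Memory K) where
  carrier := {p | HasWeakDerivOn K.support p.1 (-p.2 : Memory K) ∧ HasTrace K.support p.1 0 0}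
  zero_mem' := by
    have h0 : (0 : ℝ → H1r) =ᵐ[volume.restrict K.support] (0 : Memory K) :=
      K.ae_iff.1 (Lp.coeFn_zero _ _ _).symm
    have h1 : (0 : ℝ → H1r) =ᵐ[volume.restrict K.support] (-(0 : Memory K) : Memory K) := by
      rwa [neg_zero]
    exact ⟨(HasWeakDerivOn.zero _).congr h0 h1,
      (HasTrace.zero _ _).congr K.isOpen_support.measurableSet h0⟩
  add_mem' := by
    rintro p q ⟨hp1, hp2⟩ ⟨hq1, hq2⟩
    have h1 := K.ae_iff.1 (Lp.coeFn_add p.1 q.1).symm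
    have h2 := K.ae_iff.1 (Lp.coeFn_add (-p.2) (-q.2)).symm
    rw [← neg_add] at h2
    refine ⟨(hp1.add hq1).congr h1 h2, ?_⟩
    have := (hp2.add hq2).congr K.isOpen_support.measurableSet h1
    rwa [add_zero] at this
  smul_mem' := by
    rintro r p ⟨hp1, hp2⟩
    have h1 := K.ae_iff.1 (Lp.coeFn_smul r p.1).symm
    have h2 := K.ae_iff.1 (Lp.coeFn_smul r (-p.2)).symm
    rw [smul_neg] at h2
    refine ⟨(hp1.smul r).congr h1 h2, ?_⟩
    have := (hp2.smul r).congr K.isOpen_support.measurableSet h1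
    rwa [smul_zero] at this

theorem translationGraph_functional (K : MemoryKernel) (p : Memory K × Memory K)
    (hp : p ∈ translationGraph K) (h0 : p.1 = 0) : p.2 = 0 := by
  have h1 : HasWeakDerivOn K.support p.1 (-p.2 : Memory K) := hp.1
  rw [h0] at h1
  have h2 := (h1.congr (K.ae_iff.1 (Lp.coeFn_zero _ _ _)) (ae_eq_refl _)).ae_eq_zero
    K.isOpen_support
  have h2' : (-p.2 : Memory K) =ᵐ[K.measure] (0 : ℝ → H1r) := K.ae_iff.2 h2
  have h3 : (-p.2 : Memory K) = 0 := Lp.ext (h2'.trans (Lp.coeFn_zero _ _ _).symm)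
  exact neg_eq_zero.1 h3

/-- The generator `T` of the right-translation semigroup on the memory space. -/
def translationGenerator (K : MemoryKernel) : Memory K →ₗ.[ℂ] Memory K :=
  (translationGraph K).toLinearPMap

theorem mem_translationGenerator_graph (K : MemoryKernel) (p : Memory K × Memory K) :
    p ∈ (translationGenerator K).graph ↔
      HasWeakDerivOn K.support p.1 (-p.2 : Memory K) ∧ HasTrace K.support p.1 0 0 := by
  rw [translationGenerator, Submodule.toLinearPMap_graph_eq _ (translationGraph_functional K)]
  rfl

/-- The state space `H¹_l(-1,0) × L²(-1,0) × L²(0,1) × M` with its Hilbert space structure. -/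
abbrev StateSpace (K : MemoryKernel) : Type :=
  WithLp 2 (H1l × WithLp 2 (L2 (-1) 0 × WithLp 2 (L2 0 1 × Memory K)))

namespace StateSpace

variable {K : MemoryKernel}

/-- The component `u` of the state `(u,v,w,η)`. -/
def u (z : StateSpace K) : H1l := z.fst

/-- The component `v` of the state `(u,v,w,η)`. -/
def v (z : StateSpace K) : L2 (-1) 0 := z.snd.fst

/-- The component `w` of the state `(u,v,w,η)`. -/
def w (z : StateSpace K) : L2 0 1 := z.snd.snd.fst

/-- The component `η` of the state `(u,v,w,η)`. -/
def η (z : StateSpace K) : Memory K := z.snd.snd.snd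

theorem ext {z z' : StateSpace K} (h1 : z.u = z'.u) (h2 : z.v = z'.v) (h3 : z.w = z'.w)
    (h4 : z.η = z'.η) : z = z' :=
  WithLp.ofLp_injective 2 (Prod.ext h1 (WithLp.ofLp_injective 2
    (Prod.ext h2 (WithLp.ofLp_injective 2 (Prod.ext h3 h4)))))

end StateSpace

/-- The function `φ = w + ∫_0^∞ μ(s) η(s) ds`, for `w ∈ H¹_r(0,1)` and `η ∈ M`. -/
def flux {K : MemoryKernel} (w : H1r) (η : Memory K) : H1r := w + ∫ s, η s ∂K.measure

/-- The pair `(z, y)` satisfies `z ∈ D(𝔸)` and `y = 𝔸 z`: with `z = (u,v,w,η)`,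
`v ∈ H¹_l(-1,0)`, `w ∈ H¹_r(0,1)`, `u ∈ H²(-1,0)`, `φ ∈ H²(0,1)`, `η ∈ D(T)`,
`u'(0) = φ'(0)`, `v(0) = w(0)` and `y = (v, u'', φ'', Tη + w)`. -/
def IsSystemPair {K : MemoryKernel} (z y : StateSpace K) : Prop :=
  ∃ (v : H1l) (w : H1r) (u'' : L2 (-1) 0) (φ'' : L2 0 1) (Tη : Memory K),
    v.toL2 = z.v ∧ w.toL2 = z.w ∧
    HasWeakDerivOn (Ioo (-1) 0) z.u.deriv u'' ∧
    HasWeakDerivOn (Ioo 0 1) (flux w z.η).deriv φ'' ∧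
    (z.η, Tη) ∈ (translationGenerator K).graph ∧
    (∃ c : ℂ, HasTrace (Ioo (-1) 0) z.u.deriv 0 c ∧ HasTrace (Ioo 0 1) (flux w z.η).deriv 0 c) ∧
    (∃ c : ℂ, HasTrace (Ioo (-1) 0) v.toL2 0 c ∧ HasTrace (Ioo 0 1) w.toL2 0 c) ∧
    y.u = v ∧ y.v = u'' ∧ y.w = φ'' ∧ y.η = Tη + Lp.const 2 K.measure w

theorem flux_add {K : MemoryKernel} (w w' : H1r) (η η' : Memory K) :
    flux (w + w') (η + η') = flux w η + flux w' η' := by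
  have i1 : Integrable η K.measure := (Lp.memLp η).integrable (by norm_num)
  have i2 : Integrable η' K.measure := (Lp.memLp η').integrable (by norm_num)
  rw [flux, flux, flux, integral_congr_ae (Lp.coeFn_add η η')]
  simp only [Pi.add_apply]
  rw [integral_add i1 i2]
  abel

theorem flux_smul {K : MemoryKernel} (r : ℂ) (w : H1r) (η : Memory K) :
    flux (r • w) (r • η) = r • flux w η := by
  rw [flux, flux, integral_congr_ae (Lp.coeFn_smul r η)]
  simp only [Pi.smul_apply]
  rw [integral_smul, smul_add]

theorem flux_zero {K : MemoryKernel} : flux (0 : H1r) (0 : Memory K) = 0 := by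
  have := flux_smul (0 : ℂ) (0 : H1r) (0 : Memory K)
  rwa [zero_smul, zero_smul, zero_smul] at this

theorem H1.deriv_traces_add {a b a' b' e : ℝ} {f g : L2 a b} {f' g' : L2 a' b'}
    (hf : ∃ c : ℂ, HasTrace (Ioo a b) f e c ∧ HasTrace (Ioo a' b') f' e c)
    (hg : ∃ c : ℂ, HasTrace (Ioo a b) g e c ∧ HasTrace (Ioo a' b') g' e c) :
    ∃ c : ℂ, HasTrace (Ioo a b) (f + g : L2 a b) e c ∧
      HasTrace (Ioo a' b') (f' + g' : L2 a' b') e c := by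
  obtain ⟨c, h1, h2⟩ := hf
  obtain ⟨d, h3, h4⟩ := hg
  exact ⟨c + d, (h1.add h3).congr measurableSet_Ioo (Lp.coeFn_add f g).symm,
    (h2.add h4).congr measurableSet_Ioo (Lp.coeFn_add f' g').symm⟩

theorem H1.deriv_traces_smul {a b a' b' e : ℝ} (r : ℂ) {f : L2 a b} {f' : L2 a' b'}
    (hf : ∃ c : ℂ, HasTrace (Ioo a b) f e c ∧ HasTrace (Ioo a' b') f' e c) :
    ∃ c : ℂ, HasTrace (Ioo a b) (r • f : L2 a b) e c ∧
      HasTrace (Ioo a' b') (r • f' : L2 a' b') e c := by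
  obtain ⟨c, h1, h2⟩ := hf
  exact ⟨r • c, (h1.smul r).congr measurableSet_Ioo (Lp.coeFn_smul r f).symm,
    (h2.smul r).congr measurableSet_Ioo (Lp.coeFn_smul r f').symm⟩

theorem hasWeakDerivOn_L2_add {a b : ℝ} {f f' g g' : L2 a b}
    (hf : HasWeakDerivOn (Ioo a b) f f') (hg : HasWeakDerivOn (Ioo a b) g g') :
    HasWeakDerivOn (Ioo a b) (f + g : L2 a b) (f' + g' : L2 a b) :=
  (hf.add hg).congr (Lp.coeFn_add f g).symm (Lp.coeFn_add f' g').symm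

theorem hasWeakDerivOn_L2_smul {a b : ℝ} (r : ℂ) {f f' : L2 a b}
    (hf : HasWeakDerivOn (Ioo a b) f f') :
    HasWeakDerivOn (Ioo a b) (r • f : L2 a b) (r • f' : L2 a b) :=
  (hf.smul r).congr (Lp.coeFn_smul r f).symm (Lp.coeFn_smul r f').symm

theorem IsSystemPair.add {K : MemoryKernel} {z y z' y' : StateSpace K}
    (h : IsSystemPair z y) (h' : IsSystemPair z' y') : IsSystemPair (z + z') (y + y') := by
  obtain ⟨v, w, a, b, t, h1, h2, h3, h4, h5, h6, h7, h8, h9, h10, h11⟩ := h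
  obtain ⟨v', w', a', b', t', k1, k2, k3, k4, k5, k6, k7, k8, k9, k10, k11⟩ := h'
  have e1 : (z + z').u = z.u + z'.u := rfl
  have e2 : (z + z').η = z.η + z'.η := rfl
  refine ⟨v + v', w + w', a + a', b + b', t + t', ?_, ?_, ?_, ?_, ?_, ?_, ?_, ?_, ?_, ?_, ?_⟩
  · rw [map_add, h1, k1]; rfl
  · rw [map_add, h2, k2]; rfl
  · rw [e1, map_add]; exact hasWeakDerivOn_L2_add h3 k3
  · rw [e2, flux_add, map_add]; exact hasWeakDerivOn_L2_add h4 k4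
  · exact (translationGenerator K).graph.add_mem h5 k5
  · rw [e1, e2, flux_add, map_add, map_add]; exact H1.deriv_traces_add h6 k6
  · rw [map_add, map_add]; exact H1.deriv_traces_add h7 k7
  · rw [← h8, ← k8]; rfl
  · rw [← h9, ← k9]; rfl
  · rw [← h10, ← k10]; rfl
  · rw [map_add, add_add_add_comm, ← h11, ← k11]; rfl

theorem IsSystemPair.smul {K : MemoryKernel} {z y : StateSpace K} (r : ℂ)
    (h : IsSystemPair z y) : IsSystemPair (r • z) (r • y) := by
  obtain ⟨v, w, a, b, t, h1, h2, h3, h4, h5, h6, h7, h8, h9, h10, h11⟩ := h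
  have e1 : (r • z).u = r • z.u := rfl
  have e2 : (r • z).η = r • z.η := rfl
  refine ⟨r • v, r • w, r • a, r • b, r • t, ?_, ?_, ?_, ?_, ?_, ?_, ?_, ?_, ?_, ?_, ?_⟩
  · rw [map_smul, h1]; rfl
  · rw [map_smul, h2]; rfl
  · rw [e1, map_smul]; exact hasWeakDerivOn_L2_smul r h3
  · rw [e2, flux_smul, map_smul]; exact hasWeakDerivOn_L2_smul r h4
  · exact (translationGenerator K).graph.smul_mem r h5
  · rw [e1, e2, flux_smul, map_smul, map_smul]; exact H1.deriv_traces_smul r h6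
  · rw [map_smul, map_smul]; exact H1.deriv_traces_smul r h7
  · rw [← h8]; rfl
  · rw [← h9]; rfl
  · rw [← h10]; rfl
  · have : Lp.const 2 K.measure (r • w) = r • Lp.const 2 K.measure w :=
      (Lp.constₗ 2 K.measure ℂ).map_smul r w
    rw [this, ← smul_add, ← h11]; rfl

theorem IsSystemPair.zero {K : MemoryKernel} : IsSystemPair (0 : StateSpace K) 0 := by
  have hw : ∀ a b : ℝ, HasWeakDerivOn (Ioo a b) (0 : L2 a b) (0 : L2 a b) := fun a b =>
    (HasWeakDerivOn.zero _).congr (Lp.coeFn_zero _ _ _).symm (Lp.coeFn_zero _ _ _).symm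
  have ht : ∀ a b e : ℝ, HasTrace (Ioo a b) (0 : L2 a b) e 0 := fun a b e =>
    (HasTrace.zero _ _).congr measurableSet_Ioo (Lp.coeFn_zero _ _ _).symm
  have e1 : (0 : StateSpace K).u = 0 := rfl
  have e2 : (0 : StateSpace K).η = 0 := rfl
  refine ⟨0, 0, 0, 0, 0, ?_, ?_, ?_, ?_, ?_, ⟨0, ?_⟩, ⟨0, ?_⟩, rfl, rfl, rfl, ?_⟩
  · rw [map_zero]; rfl
  · rw [map_zero]; rfl
  · rw [e1, map_zero]; exact hw _ _
  · rw [e2, flux_zero, map_zero]; exact hw _ _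
  · exact (translationGenerator K).graph.zero_mem
  · rw [e1, e2, flux_zero, map_zero, map_zero]; exact ⟨ht _ _ _, ht _ _ _⟩
  · rw [map_zero, map_zero]; exact ⟨ht _ _ _, ht _ _ _⟩
  · rw [map_zero, add_zero]; rfl

theorem L2.eq_zero_of_hasWeakDerivOn {a b : ℝ} {f' : L2 a b}
    (h : HasWeakDerivOn (Ioo a b) (0 : L2 a b) f') : f' = 0 :=
  Lp.ext (((h.congr (Lp.coeFn_zero _ _ _) (ae_eq_refl _)).ae_eq_zero isOpen_Ioo).trans
    (Lp.coeFn_zero _ _ _).symm)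

theorem H1.toL2_injective {a b e : ℝ} {φ : H1 a b e} (h : φ.toL2 = 0) : φ = 0 := by
  have h1 := φ.hasWeakDerivOn
  rw [h] at h1
  exact Subtype.ext (Prod.ext h (L2.eq_zero_of_hasWeakDerivOn h1))

/-- The graph of the operator `𝔸`. -/
def systemGraph (K : MemoryKernel) : Submodule ℂ (StateSpace K × StateSpace K) where
  carrier := {p | IsSystemPair p.1 p.2}
  zero_mem' := IsSystemPair.zero
  add_mem' := IsSystemPair.add
  smul_mem' := fun r _ h => IsSystemPair.smul r h

theorem systemGraph_functional (K : MemoryKernel) (p : StateSpace K × StateSpace K)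
    (hp : p ∈ systemGraph K) (h0 : p.1 = 0) : p.2 = 0 := by
  obtain ⟨v, w, a, b, t, h1, h2, h3, h4, h5, h6, h7, h8, h9, h10, h11⟩ := hp
  rw [h0] at h1 h2 h3 h4 h5
  have hv : v = 0 := H1.toL2_injective h1
  have hw : w = 0 := H1.toL2_injective h2
  subst hv hw
  have e1 : (0 : StateSpace K).u = 0 := rfl
  have e2 : (0 : StateSpace K).η = 0 := rfl
  rw [e1, map_zero] at h3
  rw [e2, flux_zero, map_zero] at h4
  have ha : a = 0 := L2.eq_zero_of_hasWeakDerivOn h3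
  have hb : b = 0 := L2.eq_zero_of_hasWeakDerivOn h4
  have ht : t = 0 := (translationGenerator K).graph_fst_eq_zero_snd h5 rfl
  subst ha hb ht
  rw [map_zero, add_zero] at h11
  exact StateSpace.ext h8 h9 h10 h11

/-- The operator `𝔸 : D(𝔸) ⊆ 𝓗 → 𝓗`. -/
def systemOperator (K : MemoryKernel) : StateSpace K →ₗ.[ℂ] StateSpace K :=
  (systemGraph K).toLinearPMap

theorem mem_systemOperator_graph (K : MemoryKernel) (p : StateSpace K × StateSpace K) :
    p ∈ (systemOperator K).graph ↔ IsSystemPair p.1 p.2 := by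
  rw [systemOperator, Submodule.toLinearPMap_graph_eq _ (systemGraph_functional K)]
  rfl

end SystemOperator

section Spectrum

variable {X : Type*} [NormedAddCommGroup X] [NormedSpace ℂ X]

/-- The resolvent set of an unbounded operator `A : D(A) ⊆ X → X`: the `z ∈ ℂ` such that
`z - A : D(A) → X` is bijective with a bounded inverse `R : X → X`. -/
def unboundedResolventSet (A : X →ₗ.[ℂ] X) : Set ℂ :=
  {z | ∃ R : X →L[ℂ] X, (∀ y : X, ∃ x : A.domain, (x : X) = R y ∧ z • (x : X) - A x = y) ∧
    ∀ x : A.domain, R (z • (x : X) - A x) = x}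

/-- The spectrum of an unbounded operator. -/
def unboundedSpectrum (A : X →ₗ.[ℂ] X) : Set ℂ := (unboundedResolventSet A)ᶜ

end Spectrum

section CharacteristicFunctions

/-- `ℓ(z) = 1 + z⁻¹ ∫_0^∞ μ(s) (1 - e^{-zs}) ds`. -/
def MemoryKernel.ell (K : MemoryKernel) (z : ℂ) : ℂ :=
  1 + z⁻¹ * ∫ s in Ioi (0 : ℝ), (K.μ s : ℂ) * (1 - Complex.exp (-z * s))

/-- The strip `Π_δ = {z : -δ/2 < Re z ≤ 0}`. -/
def strip (δ : ℝ) : Set ℂ := {z | -δ / 2 < z.re ∧ z.re ≤ 0}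

/-- The set `Z_ℓ` of zeros of `ℓ` in `Π_δ \ {0}`. -/
def MemoryKernel.zeroSet (K : MemoryKernel) (δ : ℝ) : Set ℂ :=
  {z | z ∈ strip δ ∧ z ≠ 0 ∧ K.ell z = 0}

/-- The principal square root (branch cut along `(-∞,0]`, non-negative real part). -/
def principalSqrt (z : ℂ) : ℂ := z ^ (1 / 2 : ℂ)

theorem principalSqrt_sq (z : ℂ) : principalSqrt z ^ 2 = z := by
  rw [principalSqrt, one_div]
  exact_mod_cast Complex.cpow_nat_inv_pow z two_ne_zero

/-- `ℓ √(z/ℓ)` is a square root of `ℓ z`. -/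
theorem mul_principalSqrt_div_sq {l : ℂ} (hl : l ≠ 0) (z : ℂ) :
    (l * principalSqrt (z / l)) ^ 2 = l * z := by
  rw [mul_pow, principalSqrt_sq]
  field_simp

/-- The set `Σ` of all `z ∈ Π_δ \ (Z_ℓ ∪ {0})` with
`√(ℓ(z)z) sinh z cosh √(z/ℓ(z)) + cosh z sinh √(z/ℓ(z)) = 0`, where `√(z/ℓ(z))` is the principal
square root and `√(ℓ(z)z) = ℓ(z) √(z/ℓ(z))` is the corresponding square root of `ℓ(z)z`. -/
def MemoryKernel.sigmaSet (K : MemoryKernel) (δ : ℝ) : Set ℂ :=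
  {z | z ∈ strip δ ∧ z ≠ 0 ∧ K.ell z ≠ 0 ∧
    K.ell z * principalSqrt (z / K.ell z) * Complex.sinh z *
        Complex.cosh (principalSqrt (z / K.ell z)) +
      Complex.cosh z * Complex.sinh (principalSqrt (z / K.ell z)) = 0}

end CharacteristicFunctions

end

/-!
The resolvent equation `(λ - 𝔸) z = y` is solved explicitly on the strip `Re λ > -δ/2`.

For such `λ` the memory variable can be eliminated. The equation `λ η + η_s = w + ξ`, `η(0) = 0`,
has the solution `η(s) = ∫_0^s e^{-λ(s-r)} (w + ξ(r)) dr`, and the decay of `μ` makes this a bounded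
operator of `ξ ∈ M` (`lintegral_memorySol_sq_le`: Cauchy–Schwarz with the exponential weight split
evenly, then Tonelli). For constant data its `μ`-integral is `(ℓ(λ) - 1) w`, so the flux is
`φ = ℓ(λ) w + Ψ(ξ)` with a bounded operator `Ψ`. Here `ℓ` is extended to `λ = 0` by `ℓ(0) = 2`,
which is where the unit mass of `g` enters (`MemoryKernel.ellExt_zero`).

* If `ℓ(λ) = 0`, then `φ` does not see `w`, and the datum `(0,0,1,0)` forces `λ w = 1`, which is
  incompatible with `w(1) = 0`; hence `λ` is in the spectrum.
* If `ℓ(λ) ≠ 0`, then `w = (φ - Ψ)/ℓ`, and what remains is a pair of second order equations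
  `u'' = λ² u + F`, `φ'' = k² φ + G` with `k² = λ/ℓ`, `u(-1) = 0`, `φ(1) = 0`. Their solutions are
  particular solutions plus multiples of `sinh(λ(x+1))/λ` and `sinh(k(x-1))/k`. The conditions
  `u'(0) = φ'(0)`, `v(0) = w(0)` become a `2 × 2` linear system for the two coefficients, whose
  determinant is `D = cosh λ · sinh k/(kℓ) + sinh λ cosh k`. For `D ≠ 0` Cramer's rule gives a
  bounded inverse; for `D = 0` there is an eigenvector. For `λ ≠ 0` the characteristic function of
  the theorem is `k ℓ D`, and at `λ = 0` one has `D = 1/2`.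

Particular solutions come from the factorization `∂² - k² = (∂ - k)(∂ + k)`: the first order
operator `∂ - k` is a bijection of `{r ∈ H¹ : r(e) = 0}` onto `L²`, with a bounded inverse by the
open mapping theorem. Dividing `sinh(kx)` by `k` keeps the formulas valid for `k = 0`, so that
the resolvent equation at `λ = 0` is solved by the same formulas.
-/

noncomputable section

/-! ### Calculus of weak derivatives and traces -/

section WeakCalculus

theorem HasTrace.unique {E : Type*} [NormedAddCommGroup E] {a b e : ℝ} (hab : a < b)
    (he : e ∈ Icc a b) {f : ℝ → E} {c d : E} (h1 : HasTrace (Ioo a b) f e c)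
    (h2 : HasTrace (Ioo a b) f e d) : c = d :=
  have := nhdsWithin_inf_ae_neBot hab he
  tendsto_nhds_unique h1 h2

theorem HasTrace.mono {E : Type*} [NormedAddCommGroup E] {U W : Set ℝ} {e : ℝ} {f : ℝ → E} {c : E}
    (h : HasTrace U f e c) (hWU : W ⊆ U) : HasTrace W f e c :=
  Tendsto.mono_left h (inf_le_inf_right _ (nhdsWithin_mono _ hWU))

theorem hasTrace_of_continuousAt {E : Type*} [NormedAddCommGroup E] {U : Set ℝ} {e : ℝ}
    {f : ℝ → E} (h : ContinuousAt f e) : HasTrace U f e (f e) :=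
  Tendsto.mono_left h (inf_le_left.trans nhdsWithin_le_nhds)

theorem HasTrace.continuousAt_smul {V : Type*} [NormedAddCommGroup V] [NormedSpace ℂ V]
    {U : Set ℝ} {e : ℝ} {f : ℝ → V} {c : V} {g : ℝ → ℂ} (hg : ContinuousAt g e)
    (h : HasTrace U f e c) : HasTrace U (fun x => g x • f x) e (g e • c) :=
  Tendsto.smul (hasTrace_of_continuousAt hg) h

theorem HasWeakDerivOn.mono {E : Type*} [NormedAddCommGroup E] [NormedSpace ℝ E] {U W : Set ℝ}
    {f f' : ℝ → E} (h : HasWeakDerivOn U f f') (hWU : W ⊆ U) :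
    HasWeakDerivOn W f f' := by
  refine ⟨h.1.mono_set hWU, h.2.1.mono_set hWU, fun θ h1 h2 h3 => ?_⟩
  have key : ∀ (η : ℝ → ℝ) (F : ℝ → E), tsupport η ⊆ W →
      ∫ s in W, η s • F s = ∫ s in U, η s • F s := by
    intro η F hη
    rw [setIntegral_eq_integral_of_forall_compl_eq_zero (fun x hx => by
        rw [image_eq_zero_of_notMem_tsupport (fun hx' => hx (hη hx')), zero_smul]),
      setIntegral_eq_integral_of_forall_compl_eq_zero (fun x hx => by
        rw [image_eq_zero_of_notMem_tsupport (fun hx' => hx (hWU (hη hx'))), zero_smul])]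
  rw [key _ _ ((tsupport_deriv_subset (f := θ)).trans h3), key _ _ h3]
  exact h.2.2 θ h1 h2 (h3.trans hWU)

/-- Weak differentiability is a local property: since test functions have compact support, it
suffices to check it on an open neighbourhood of each compact subset of `U`. -/
theorem HasWeakDerivOn.of_compact_exhaustion {E : Type*} [NormedAddCommGroup E] [NormedSpace ℝ E]
    {U : Set ℝ} {f f' : ℝ → E}
    (h : ∀ A ⊆ U, IsCompact A → ∃ W, IsOpen W ∧ A ⊆ W ∧ W ⊆ U ∧ HasWeakDerivOn W f f') :
    HasWeakDerivOn U f f' := by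
  have loc : ∀ x ∈ U, IntegrableAtFilter f (𝓝[U] x) ∧ IntegrableAtFilter f' (𝓝[U] x) := by
    intro x hx
    obtain ⟨W, hW, hxW, hWU, hd⟩ := h {x} (by simpa using hx) isCompact_singleton
    have hx' : x ∈ W := hxW rfl
    have e : 𝓝[U] x ≤ 𝓝[W] x := by
      rw [hW.nhdsWithin_eq hx']
      exact nhdsWithin_le_nhds
    exact ⟨(hd.1 x hx').filter_mono e, (hd.2.1 x hx').filter_mono e⟩
  refine ⟨fun x hx => (loc x hx).1, fun x hx => (loc x hx).2, fun θ h1 h2 h3 => ?_⟩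
  obtain ⟨W, hW, hAW, hWU, hd⟩ := h _ h3 h2
  have key : ∀ (η : ℝ → ℝ) (F : ℝ → E), tsupport η ⊆ W →
      ∫ s in U, η s • F s = ∫ s in W, η s • F s := by
    intro η F hη
    rw [setIntegral_eq_integral_of_forall_compl_eq_zero (fun x hx => by
        rw [image_eq_zero_of_notMem_tsupport (fun hx' => hx (hWU (hη hx'))), zero_smul]),
      setIntegral_eq_integral_of_forall_compl_eq_zero (fun x hx => by
        rw [image_eq_zero_of_notMem_tsupport (fun hx' => hx (hη hx')), zero_smul])]
  rw [key _ _ ((tsupport_deriv_subset (f := θ)).trans hAW), key _ _ hAW]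
  exact hd.2.2 θ h1 h2 hAW

theorem HasWeakDerivOn.contDiff_smul_real {E : Type*} [NormedAddCommGroup E] [NormedSpace ℝ E]
    {U : Set ℝ} (hU : IsOpen U) {f f' : ℝ → E} {g g' : ℝ → ℝ} (hg : ContDiff ℝ ∞ g)
    (hg' : ∀ x, HasDerivAt g (g' x) x) (h : HasWeakDerivOn U f f') :
    HasWeakDerivOn U (fun x => g x • f x) (fun x => g' x • f x + g x • f' x) := by
  have eg : deriv g = g' := funext fun x => (hg' x).deriv
  have cg' : Continuous g' := eg ▸ hg.continuous_deriv (by simp)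
  have l1 := h.1.continuousOn_smul hU.isLocallyClosed hg.continuous.continuousOn
  have l2 := h.1.continuousOn_smul hU.isLocallyClosed cg'.continuousOn
  have l3 := h.2.1.continuousOn_smul hU.isLocallyClosed hg.continuous.continuousOn
  refine ⟨l1, l2.add l3, fun θ h1 h2 h3 => ?_⟩
  have dθ : ∀ x, HasDerivAt θ (deriv θ x) x := fun x =>
    (h1.differentiable (by simp) x).hasDerivAt
  have e1 : deriv (fun x => θ x * g x) = fun x => deriv θ x * g x + θ x * g' x :=
    funext fun x => ((dθ x).mul (hg' x)).deriv
  have e2 := h.2.2 (fun x => θ x * g x) (h1.mul hg) (h2.mul_right)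
    ((tsupport_mul_subset_left).trans h3)
  have i1 := integrableOn_test_smul l1 (h1.continuous_deriv (by simp)) h2.deriv
    ((tsupport_deriv_subset (f := θ)).trans h3)
  have i2 := integrableOn_test_smul l2 h1.continuous h2 h3
  have i3 := integrableOn_test_smul l3 h1.continuous h2 h3
  rw [e1] at e2
  simp only [add_smul, mul_smul] at e2
  rw [integral_add i1 i2] at e2
  simp only [smul_add]
  rw [integral_add i2 i3, neg_add, ← e2]
  abel

/-- The product rule for a smooth complex factor and a weakly differentiable vector function. -/
theorem HasWeakDerivOn.contDiff_smul {V : Type*} [NormedAddCommGroup V] [NormedSpace ℂ V]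
    {U : Set ℝ} (hU : IsOpen U) {f f' : ℝ → V} {g g' : ℝ → ℂ} (hg : ContDiff ℝ ∞ g)
    (hg' : ∀ x, HasDerivAt g (g' x) x) (h : HasWeakDerivOn U f f') :
    HasWeakDerivOn U (fun x => g x • f x) (fun x => g' x • f x + g x • f' x) := by
  have r1 : ContDiff ℝ ∞ fun x => (g x).re := Complex.reCLM.contDiff.comp hg
  have r2 : ContDiff ℝ ∞ fun x => (g x).im := Complex.imCLM.contDiff.comp hg
  have d1 : ∀ x, HasDerivAt (fun x => (g x).re) (g' x).re x := fun x =>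
    Complex.reCLM.hasFDerivAt.comp_hasDerivAt x (hg' x)
  have d2 : ∀ x, HasDerivAt (fun x => (g x).im) (g' x).im x := fun x =>
    Complex.imCLM.hasFDerivAt.comp_hasDerivAt x (hg' x)
  have split : ∀ (z : ℂ) (y : V), z • y = z.re • y + Complex.I • z.im • y := by
    intro z y
    conv_lhs => rw [← Complex.re_add_im z]
    rw [add_smul, mul_comm, mul_smul, Complex.coe_smul, Complex.coe_smul]
  have := (h.contDiff_smul_real hU r1 d1).add
    ((h.contDiff_smul_real hU r2 d2).smul Complex.I)
  refine this.congr (ae_of_all _ fun x => ?_) (ae_of_all _ fun x => ?_)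
  · simp [split (g x)]
  · simp only [Pi.add_apply, Pi.smul_apply, split (g x), split (g' x), smul_add]
    abel

theorem hasWeakDerivOn_of_contDiff {U : Set ℝ} (hU : IsOpen U) {g g' : ℝ → ℂ}
    (hg : ContDiff ℝ ∞ g) (hg' : ∀ x, HasDerivAt g (g' x) x) : HasWeakDerivOn U g g' := by
  have h1 : HasWeakDerivOn U (fun _ => (1 : ℂ)) 0 := by
    refine ⟨(locallyIntegrable_const _).locallyIntegrableOn _,
      locallyIntegrable_zero.locallyIntegrableOn _, fun θ h1 h2 h3 => ?_⟩
    have h3' : tsupport (deriv θ) ⊆ U := (tsupport_deriv_subset (f := θ)).trans h3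
    rw [setIntegral_eq_integral_of_forall_compl_eq_zero (fun x hx => by
      rw [image_eq_zero_of_notMem_tsupport (fun hx' => hx (h3' hx')), zero_smul])]
    have d0 : ∫ x, deriv θ x = 0 := integral_eq_zero_of_hasDerivAt_of_integrable
      (fun x => (h1.differentiable (by simp) x).hasDerivAt)
      ((h1.continuous_deriv (by simp)).integrable_of_hasCompactSupport h2.deriv)
      (h1.continuous.integrable_of_hasCompactSupport h2)
    rw [integral_smul_const, d0]
    simp
  refine (h1.contDiff_smul hU hg hg').congr (ae_of_all _ fun x => ?_) (ae_of_all _ fun x => ?_)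
  · simp
  · simp

theorem hasDerivAt_exp_mul (c : ℂ) (x : ℝ) :
    HasDerivAt (fun x : ℝ => Complex.exp (c * x)) (c * Complex.exp (c * x)) x := by
  have h1 : HasDerivAt (fun x : ℝ => c * (x : ℂ)) (c * 1) x :=
    (Complex.ofRealCLM.hasDerivAt (x := x)).const_mul c
  have := h1.cexp
  rwa [mul_one, mul_comm] at this

theorem contDiff_exp_mul (c : ℂ) : ContDiff ℝ ∞ (fun x : ℝ => Complex.exp (c * x)) :=
  (contDiff_const.mul Complex.ofRealCLM.contDiff).cexp

/-- The initial value problem `f' = c f`, `f(e) = 0` has only the trivial weak solution. -/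
theorem HasWeakDerivOn.ae_eq_zero_of_smul {V : Type*} [NormedAddCommGroup V] [NormedSpace ℂ V]
    [CompleteSpace V] {a b e : ℝ} (hab : a < b) (he : e ∈ Icc a b) {f : ℝ → V} (c : ℂ)
    (h : HasWeakDerivOn (Ioo a b) f (fun x => c • f x)) (h0 : HasTrace (Ioo a b) f e 0) :
    f =ᵐ[volume.restrict (Ioo a b)] 0 := by
  have h1 := (h.contDiff_smul isOpen_Ioo (contDiff_exp_mul (-c))
    (hasDerivAt_exp_mul (-c))).congr (g' := 0) (ae_eq_refl _)
      (ae_of_all _ fun x => by simp only [Pi.zero_apply, smul_smul]; rw [← add_smul]; ring_nf; simp)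
  obtain ⟨d, hd⟩ := h1.ae_const hab
  have h2 := (h0.continuousAt_smul
    ((contDiff_exp_mul (-c)).continuous.continuousAt)).congr measurableSet_Ioo hd
  rw [smul_zero] at h2
  have hd0 : d = 0 := HasTrace.unique hab he tendsto_const_nhds h2
  filter_upwards [hd] with x hx
  rw [hd0, smul_eq_zero] at hx
  exact hx.resolve_left (Complex.exp_ne_zero _)

end WeakCalculus

/-! ### First and second order equations in `H¹(a,b)` -/

section SobolevSolvers

theorem norm_integral_le_Lp_two {α E : Type*} [MeasurableSpace α] [NormedAddCommGroup E]
    {μ : Measure α} [IsFiniteMeasure μ] (f : Lp E 2 μ) :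
    ∫ x, ‖f x‖ ∂μ ≤ (μ univ ^ (1 / 2 : ℝ)).toReal * ‖f‖ := by
  have h1 : ∫ x, ‖f x‖ ∂μ = (eLpNorm f 1 μ).toReal := by
    rw [eLpNorm_one_eq_lintegral_enorm,
      integral_norm_eq_lintegral_enorm (Lp.aestronglyMeasurable f)]
  have h2 : eLpNorm f 1 μ ≤ eLpNorm f 2 μ * μ univ ^ (1 / 2 : ℝ) := by
    refine (eLpNorm_le_eLpNorm_mul_rpow_measure_univ (q := 2) one_le_two
      (Lp.aestronglyMeasurable f)).trans (le_of_eq ?_)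
    norm_num
  rw [h1, Lp.norm_def, ← ENNReal.toReal_mul, mul_comm]
  exact ENNReal.toReal_mono (ENNReal.mul_ne_top (Lp.eLpNorm_ne_top f)
    (ENNReal.rpow_ne_top_of_nonneg (by norm_num) (measure_ne_top _ _))) h2

/-- Integration of square integrable functions over a finite measure space. -/
def integralL2 {α : Type*} (E : Type*) [MeasurableSpace α] [NormedAddCommGroup E] [NormedSpace ℂ E]
    (μ : Measure α) [IsFiniteMeasure μ] : Lp E 2 μ →L[ℂ] E :=
  LinearMap.mkContinuous
    { toFun := fun f => ∫ x, f x ∂μ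
      map_add' := fun f g => by
        rw [integral_congr_ae (Lp.coeFn_add f g)]
        exact integral_add ((Lp.memLp f).integrable (by norm_num))
          ((Lp.memLp g).integrable (by norm_num))
      map_smul' := fun r f => by
        rw [integral_congr_ae (Lp.coeFn_smul r f)]
        exact integral_smul _ _ }
    (μ univ ^ (1 / 2 : ℝ)).toReal
    fun f => (norm_integral_le_integral_norm _).trans (norm_integral_le_Lp_two f)

theorem integralL2_apply {α E : Type*} [MeasurableSpace α] [NormedAddCommGroup E] [NormedSpace ℂ E]
    {μ : Measure α} [IsFiniteMeasure μ] (f : Lp E 2 μ) : integralL2 E μ f = ∫ x, f x ∂μ := rfl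

theorem memLp_two_of_continuous {a b : ℝ} {f : ℝ → ℂ} (hf : Continuous f) :
    MemLp f 2 (volume.restrict (Ioo a b)) := by
  obtain ⟨C, hC⟩ := isCompact_Icc.exists_bound_of_continuousOn (s := Icc a b) hf.continuousOn
  refine MemLp.of_bound hf.aestronglyMeasurable C ?_
  filter_upwards [ae_restrict_mem measurableSet_Ioo] with x hx using
    hC x (Ioo_subset_Icc_self hx)

theorem memLp_two_continuous_smul {a b : ℝ} {f g : ℝ → ℂ} (hg : Continuous g)
    (hf : MemLp f 2 (volume.restrict (Ioo a b))) :
    MemLp (fun x => g x • f x) 2 (volume.restrict (Ioo a b)) := by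
  obtain ⟨C, hC⟩ := isCompact_Icc.exists_bound_of_continuousOn (s := Icc a b) hg.continuousOn
  refine hf.of_le_mul (c := C) (hg.aestronglyMeasurable.smul hf.1) ?_
  filter_upwards [ae_restrict_mem measurableSet_Ioo] with x hx
  rw [norm_smul]
  exact mul_le_mul_of_nonneg_right (hC x (Ioo_subset_Icc_self hx)) (norm_nonneg _)

namespace H1

variable {a b e : ℝ}

/-- The element of `{φ ∈ H¹(a,b) : φ(e) = 0}` given by a function and its weak derivative. -/
def ofFun {f f' : ℝ → ℂ} (hf : MemLp f 2 (volume.restrict (Ioo a b)))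
    (hf' : MemLp f' 2 (volume.restrict (Ioo a b))) (hd : HasWeakDerivOn (Ioo a b) f f')
    (h0 : HasTrace (Ioo a b) f e 0) : H1 a b e :=
  ⟨(hf.toLp f, hf'.toLp f'), hd.congr hf.coeFn_toLp.symm hf'.coeFn_toLp.symm,
    h0.congr measurableSet_Ioo hf.coeFn_toLp.symm⟩

variable [hab : Endpoint a b e]

theorem ae_eq_primitive (φ : H1 a b e) : φ.toL2 =ᵐ[volume.restrict (Ioo a b)]
    fun x => ∫ t in e..x, (Ioo a b).indicator φ.deriv t := by
  have hv : Integrable φ.deriv (volume.restrict (Ioo a b)) :=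
    (Lp.memLp φ.deriv).integrable (by norm_num)
  have iw : Integrable ((Ioo a b).indicator φ.deriv) :=
    (integrable_indicator_iff measurableSet_Ioo).2 hv
  have hcont : Continuous fun x => ∫ t in e..x, (Ioo a b).indicator φ.deriv t :=
    intervalIntegral.continuous_primitive (fun _ _ => iw.intervalIntegrable) e
  have h1 := φ.hasWeakDerivOn.add ((hasWeakDerivOn_primitive (a := a) (b := b) e iw).smul (-1 : ℂ))
  have h2 : HasTrace (Ioo a b) _ e _ := φ.hasTrace.add
    (HasTrace.smul (-1 : ℂ) (hasTrace_of_continuousAt (U := Ioo a b) (hcont.continuousAt (x := e))))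
  rw [intervalIntegral.integral_same, smul_zero, add_zero] at h2
  have h3 := (h1.congr (g' := fun x => (0 : ℂ) • _) (ae_eq_refl _) (by
    filter_upwards [indicator_ae_eq_restrict (f := φ.deriv) measurableSet_Ioo] with x hx
    simp [hx])).ae_eq_zero_of_smul hab.lt hab.mem 0 h2
  filter_upwards [h3] with x hx
  simpa [add_neg_eq_zero] using hx

theorem hasTrace_integral (φ : H1 a b e) (x : ℝ) :
    HasTrace (Ioo a b) φ.toL2 x (∫ t in e..x, (Ioo a b).indicator φ.deriv t) := by
  have hv : Integrable φ.deriv (volume.restrict (Ioo a b)) :=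
    (Lp.memLp φ.deriv).integrable (by norm_num)
  have iw : Integrable ((Ioo a b).indicator φ.deriv) :=
    (integrable_indicator_iff measurableSet_Ioo).2 hv
  have hcont : Continuous fun x => ∫ t in e..x, (Ioo a b).indicator φ.deriv t :=
    intervalIntegral.continuous_primitive (fun _ _ => iw.intervalIntegrable) e
  exact (hasTrace_of_continuousAt hcont.continuousAt).congr measurableSet_Ioo φ.ae_eq_primitive.symm

theorem norm_toL2_le : ∃ C, ∀ φ : H1 a b e, ‖φ.toL2‖ ≤ C * ‖φ‖ := by
  set μ := volume.restrict (Ioo a b)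
  refine ⟨(μ.real univ) ^ ((2 : ℝ≥0∞).toReal⁻¹) * (μ univ ^ (1 / 2 : ℝ)).toReal, fun φ => ?_⟩
  have hv : Integrable φ.deriv (volume.restrict (Ioo a b)) :=
    (Lp.memLp φ.deriv).integrable (by norm_num)
  have hN : 0 ≤ (μ univ ^ (1 / 2 : ℝ)).toReal * ‖φ‖ := by positivity
  rw [mul_assoc]
  refine Lp.norm_le_of_ae_bound hN ?_
  filter_upwards [φ.ae_eq_primitive] with x hx
  rw [hx]
  calc ‖∫ t in e..x, (Ioo a b).indicator φ.deriv t‖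
      ≤ ∫ t in uIoc e x, ‖(Ioo a b).indicator φ.deriv t‖ :=
        intervalIntegral.norm_integral_le_integral_norm_uIoc
    _ ≤ ∫ t, ‖(Ioo a b).indicator φ.deriv t‖ :=
        setIntegral_le_integral ((integrable_indicator_iff measurableSet_Ioo).2 hv).norm
          (ae_of_all _ fun _ => norm_nonneg _)
    _ = ∫ t in Ioo a b, ‖φ.deriv t‖ := by
        simp only [norm_indicator_eq_indicator_norm]
        exact integral_indicator measurableSet_Ioo
    _ ≤ _ := by
        rw [← φ.norm_deriv]
        exact norm_integral_le_Lp_two φ.deriv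

/-- The embedding of `{φ ∈ H¹(a,b) : φ(e) = 0}` into `L²(a,b)`, as a bounded operator. -/
def toL2L (a b e : ℝ) [Endpoint a b e] : H1 a b e →L[ℂ] L2 a b :=
  LinearMap.mkContinuousOfExistsBound H1.toL2 norm_toL2_le

/-- The operator `r ↦ r' - k r` on `{r ∈ H¹(a,b) : r(e) = 0}`. -/
def firstOrder (a b e : ℝ) [Endpoint a b e] (k : ℂ) : H1 a b e →L[ℂ] L2 a b :=
  (derivEquiv a b e : H1 a b e →L[ℂ] L2 a b) - k • toL2L a b e

theorem firstOrder_apply (k : ℂ) (r : H1 a b e) :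
    firstOrder a b e k r = r.deriv - k • r.toL2 := rfl

theorem firstOrder_injective (k : ℂ) {r : H1 a b e} (h : firstOrder a b e k r = 0) : r = 0 := by
  rw [firstOrder_apply, sub_eq_zero] at h
  have h1 := r.hasWeakDerivOn
  rw [h] at h1
  have h2 := (h1.congr (ae_eq_refl _) (Lp.coeFn_smul k r.toL2)).ae_eq_zero_of_smul hab.lt hab.mem k
    r.hasTrace
  exact toL2_injective (Lp.ext (h2.trans (Lp.coeFn_zero _ _ _).symm))

/-- Variation of constants: `r(x) = e^{kx} ∫_e^x e^{-kt} F(t) dt` solves `r' - k r = F`. -/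
theorem firstOrder_surjective (k : ℂ) (F : L2 a b) : ∃ r, firstOrder a b e k r = F := by
  have c1 := (contDiff_exp_mul (-k)).continuous
  have c2 := (contDiff_exp_mul k).continuous
  have m1 := memLp_two_continuous_smul c1 (Lp.memLp F)
  obtain ⟨ψ, hψ⟩ := deriv_surjective (e := e) (m1.toLp _)
  have m2 := memLp_two_continuous_smul c2 (Lp.memLp ψ.toL2)
  have m3 := (m2.const_smul k).add (Lp.memLp F)
  have d := (ψ.hasWeakDerivOn.contDiff_smul isOpen_Ioo (contDiff_exp_mul k)
    (hasDerivAt_exp_mul k)).congr (ae_eq_refl _) (g' := _) (by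
      have h1 := m1.coeFn_toLp
      rw [← hψ] at h1
      filter_upwards [h1] with x hx
      rw [hx, smul_smul, ← Complex.exp_add, mul_smul]
      simp only [neg_mul, add_neg_cancel, Complex.exp_zero, one_smul]
      rfl : _ =ᵐ[_] (k • fun x : ℝ => Complex.exp (k * x) • ψ.toL2 x) + ⇑F)
  have t := ψ.hasTrace.continuousAt_smul c2.continuousAt
  rw [smul_zero] at t
  refine ⟨ofFun m2 m3 d t, ?_⟩
  rw [firstOrder_apply, sub_eq_iff_eq_add]
  change m3.toLp _ = F + k • m2.toLp _
  refine Lp.ext ?_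
  filter_upwards [m3.coeFn_toLp, m2.coeFn_toLp, Lp.coeFn_add F (k • m2.toLp _),
    Lp.coeFn_smul k (m2.toLp _)] with x h1 h2 h3 h4
  rw [h1, h3, Pi.add_apply, Pi.add_apply, h4, Pi.smul_apply, Pi.smul_apply, h2, add_comm]

/-- The bounded solution operator of `r' - k r = F`, `r(e) = 0`. -/
def solveFirst (a b e : ℝ) [Endpoint a b e] (k : ℂ) : L2 a b →L[ℂ] H1 a b e :=
  (ContinuousLinearEquiv.ofBijective (firstOrder a b e k)
    ((LinearMap.ker_eq_bot').2 fun _ => firstOrder_injective k)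
    (LinearMap.range_eq_top.2 (firstOrder_surjective k))).symm

theorem deriv_solveFirst (k : ℂ) (F : L2 a b) :
    (solveFirst a b e k F).deriv = k • (solveFirst a b e k F).toL2 + F := by
  have h : firstOrder a b e k (solveFirst a b e k F) = F :=
    ContinuousLinearEquiv.ofBijective_apply_symm_apply _ _ _ F
  rw [firstOrder_apply, sub_eq_iff_eq_add, add_comm] at h
  exact h

/-- The bounded solution operator of `φ'' - k² φ = F`, `φ(e) = φ'(e) = 0`, obtained from the
factorization `∂² - k² = (∂ - k)(∂ + k)`. -/
def solveSecond (a b e : ℝ) [Endpoint a b e] (k : ℂ) : L2 a b →L[ℂ] H1 a b e :=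
  solveFirst a b e (-k) ∘L toL2L a b e ∘L solveFirst a b e k

/-- The derivative `φ'` of the solution of `φ'' - k² φ = F`, `φ(e) = φ'(e) = 0`; it again
belongs to `{χ ∈ H¹(a,b) : χ(e) = 0}`. -/
def solveSecondDeriv (a b e : ℝ) [Endpoint a b e] (k : ℂ) : L2 a b →L[ℂ] H1 a b e :=
  solveFirst a b e k - k • solveSecond a b e k

theorem deriv_solveSecond (k : ℂ) (F : L2 a b) :
    (solveSecond a b e k F).deriv = (solveSecondDeriv a b e k F).toL2 := by
  change (solveFirst a b e (-k) (solveFirst a b e k F).toL2).deriv =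
    (solveFirst a b e k F - k • solveSecond a b e k F).toL2
  rw [deriv_solveFirst, map_sub, map_smul, neg_smul, sub_eq_add_neg, add_comm]
  rfl

theorem deriv_solveSecondDeriv (k : ℂ) (F : L2 a b) :
    (solveSecondDeriv a b e k F).deriv = k ^ 2 • (solveSecond a b e k F).toL2 + F := by
  change (solveFirst a b e k F - k • solveSecond a b e k F).deriv = _
  rw [map_sub, map_smul, deriv_solveFirst, deriv_solveSecond]
  change k • (solveFirst a b e k F).toL2 + F -
    k • (solveFirst a b e k F - k • solveSecond a b e k F).toL2 = _
  rw [map_sub, map_smul]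
  module

end H1

/-- The function `x ↦ sinh(kx)/k`, with the limiting value `x` at `k = 0`: the solution of
`S'' = k² S`, `S(0) = 0`, `S'(0) = 1`. -/
def sinhDiv (k : ℂ) (x : ℝ) : ℂ := if k = 0 then x else Complex.sinh (k * x) / k

theorem mul_sinhDiv (k : ℂ) (x : ℝ) : k * sinhDiv k x = Complex.sinh (k * x) := by
  by_cases h : k = 0
  · simp [h]
  · rw [sinhDiv, if_neg h, mul_div_cancel₀ _ h]

theorem sinhDiv_neg (k : ℂ) (x : ℝ) : sinhDiv k (-x) = -sinhDiv k x := by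
  by_cases h : k = 0
  · simp [h, sinhDiv]
  · simp [h, sinhDiv, Complex.sinh_neg, neg_div]

theorem contDiff_sinhDiv (k : ℂ) (e : ℝ) : ContDiff ℝ ∞ fun x => sinhDiv k (x - e) := by
  have h1 : ContDiff ℝ ∞ fun x : ℝ => ((x - e : ℝ) : ℂ) :=
    Complex.ofRealCLM.contDiff.comp (contDiff_id.sub contDiff_const)
  by_cases h : k = 0
  · simpa [h, sinhDiv] using h1
  · simp only [sinhDiv, if_neg h]
    exact ((Complex.contDiff_sinh.restrict_scalars ℝ).comp (contDiff_const.mul h1)).div_const k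

theorem contDiff_cosh_mul (k : ℂ) (e : ℝ) :
    ContDiff ℝ ∞ fun x : ℝ => Complex.cosh (k * (x - e : ℝ)) :=
  (Complex.contDiff_cosh.restrict_scalars ℝ).comp
    (contDiff_const.mul (Complex.ofRealCLM.contDiff.comp (contDiff_id.sub contDiff_const)))

theorem hasDerivAt_mul_ofReal_sub (k : ℂ) (e x : ℝ) :
    HasDerivAt (fun x : ℝ => k * ((x - e : ℝ) : ℂ)) k x := by
  have h1 : HasDerivAt (fun x : ℝ => ((x - e : ℝ) : ℂ)) 1 x :=
    ((hasDerivAt_id x).sub_const e).ofReal_comp.congr_deriv (by simp)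
  simpa using h1.const_mul k

theorem hasDerivAt_sinhDiv (k : ℂ) (e x : ℝ) :
    HasDerivAt (fun x => sinhDiv k (x - e)) (Complex.cosh (k * (x - e : ℝ))) x := by
  by_cases h : k = 0
  · simpa [h, sinhDiv] using hasDerivAt_mul_ofReal_sub 1 e x
  · simp only [sinhDiv, if_neg h]
    have := ((Complex.hasDerivAt_sinh _).scomp x (hasDerivAt_mul_ofReal_sub k e x)).div_const k
    rwa [smul_eq_mul, mul_div_cancel_left₀ _ h] at this

theorem hasDerivAt_cosh_mul (k : ℂ) (e x : ℝ) :
    HasDerivAt (fun x : ℝ => Complex.cosh (k * (x - e : ℝ))) (k ^ 2 * sinhDiv k (x - e)) x := by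
  have := (Complex.hasDerivAt_cosh _).scomp x (hasDerivAt_mul_ofReal_sub k e x)
  rwa [← mul_sinhDiv, smul_eq_mul, ← mul_assoc, ← sq] at this

namespace H1

variable {a b e : ℝ}

/-- The function `x ↦ sinh(k(x-e))/k` as an element of `{φ ∈ H¹(a,b) : φ(e) = 0}`. -/
def sinhElem (a b e : ℝ) (k : ℂ) : H1 a b e :=
  ofFun (memLp_two_of_continuous (contDiff_sinhDiv k e).continuous)
    (memLp_two_of_continuous (contDiff_cosh_mul k e).continuous)
    (hasWeakDerivOn_of_contDiff isOpen_Ioo (contDiff_sinhDiv k e) (hasDerivAt_sinhDiv k e))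
    (by
      have h : HasTrace (Ioo a b) _ e _ :=
        hasTrace_of_continuousAt (contDiff_sinhDiv k e).continuous.continuousAt
      have h0 : sinhDiv k (e - e) = 0 := by simp [sinhDiv]
      rwa [h0] at h)

theorem sinhElem_toL2 (k : ℂ) : (sinhElem a b e k).toL2 =ᵐ[volume.restrict (Ioo a b)]
    fun x => sinhDiv k (x - e) :=
  (memLp_two_of_continuous (contDiff_sinhDiv k e).continuous).coeFn_toLp

theorem sinhElem_deriv (k : ℂ) : (sinhElem a b e k).deriv =ᵐ[volume.restrict (Ioo a b)]
    fun x : ℝ => Complex.cosh (k * (x - e : ℝ)) :=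
  (memLp_two_of_continuous (contDiff_cosh_mul k e).continuous).coeFn_toLp

theorem sinhElem_hasTrace (k : ℂ) (x : ℝ) :
    HasTrace (Ioo a b) (sinhElem a b e k).toL2 x (sinhDiv k (x - e)) :=
  HasTrace.congr measurableSet_Ioo (hasTrace_of_continuousAt
    (contDiff_sinhDiv k e).continuous.continuousAt) (sinhElem_toL2 k).symm

theorem sinhElem_deriv_hasTrace (k : ℂ) (x : ℝ) :
    HasTrace (Ioo a b) (sinhElem a b e k).deriv x (Complex.cosh (k * (x - e : ℝ))) :=
  HasTrace.congr measurableSet_Ioo (hasTrace_of_continuousAt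
    (contDiff_cosh_mul k e).continuous.continuousAt) (sinhElem_deriv k).symm

theorem sinhElem_deriv_hasWeakDerivOn (k : ℂ) :
    HasWeakDerivOn (Ioo a b) (sinhElem a b e k).deriv (k ^ 2 • (sinhElem a b e k).toL2 : L2 a b) :=
  (hasWeakDerivOn_of_contDiff isOpen_Ioo (contDiff_cosh_mul k e) (hasDerivAt_cosh_mul k e)).congr
    (sinhElem_deriv k).symm (by
      filter_upwards [Lp.coeFn_smul (k ^ 2) (sinhElem a b e k).toL2, sinhElem_toL2 k] with x h1 h2
      rw [h1, Pi.smul_apply, h2, smul_eq_mul])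

theorem eq_of_hasWeakDerivOn_of_hasTrace {f f' : L2 a b} (h : HasWeakDerivOn (Ioo a b) f f')
    (h0 : HasTrace (Ioo a b) f e 0) : ∃ χ : H1 a b e, χ.toL2 = f ∧ χ.deriv = f' :=
  ⟨⟨(f, f'), h, h0⟩, rfl, rfl⟩

variable [hab : Endpoint a b e]

theorem sinhElem_ne_zero (k : ℂ) : sinhElem a b e k ≠ 0 := by
  intro h
  have h1 := sinhElem_deriv_hasTrace (a := a) (b := b) (e := e) k e
  rw [h, map_zero] at h1
  have h2 := HasTrace.unique hab.lt hab.mem h1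
    ((HasTrace.zero _ _).congr measurableSet_Ioo (Lp.coeFn_zero _ _ _).symm)
  simp at h2

/-- A weakly differentiable `L²` function has a trace at the endpoint. -/
theorem exists_hasTrace {f f' : L2 a b} (h : HasWeakDerivOn (Ioo a b) f f') :
    ∃ c, HasTrace (Ioo a b) f e c := by
  obtain ⟨χ, hχ⟩ := deriv_surjective (e := e) f'
  have h1 : HasWeakDerivOn (Ioo a b) (f + (-1 : ℂ) • χ.toL2 : L2 a b) (0 : ℝ → ℂ) := by
    have := hasWeakDerivOn_L2_add h (hasWeakDerivOn_L2_smul (-1 : ℂ) χ.hasWeakDerivOn)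
    rw [hχ] at this
    refine this.congr (ae_eq_refl _) ?_
    rw [neg_one_smul, add_neg_cancel]
    exact Lp.coeFn_zero _ _ _
  obtain ⟨c, hc⟩ := h1.ae_const hab.lt
  refine ⟨c + 0, HasTrace.congr measurableSet_Ioo
    (HasTrace.add (f := fun _ => c) tendsto_const_nhds χ.hasTrace) ?_⟩
  filter_upwards [hc, Lp.coeFn_add f ((-1 : ℂ) • χ.toL2), Lp.coeFn_smul (-1 : ℂ) χ.toL2]
    with x h1 h2 h3
  rw [Pi.add_apply, ← h1, h2, Pi.add_apply, h3]
  simp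

/-- The solutions of `f'' = k² f`, `f(e) = 0`, are the multiples of `sinh(k(x-e))/k`. -/
theorem eq_smul_sinhElem {k : ℂ} {f : H1 a b e}
    (h : HasWeakDerivOn (Ioo a b) f.deriv (k ^ 2 • f.toL2 : L2 a b)) :
    ∃ c : ℂ, f = c • sinhElem a b e k := by
  obtain ⟨c, hc⟩ := exists_hasTrace (e := e) h
  refine ⟨c, ?_⟩
  set g := f - c • sinhElem a b e k with hg
  have h1 : HasWeakDerivOn (Ioo a b) g.deriv (k ^ 2 • g.toL2 : L2 a b) := by
    have := hasWeakDerivOn_L2_add h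
      (hasWeakDerivOn_L2_smul (-c) (sinhElem_deriv_hasWeakDerivOn (e := e) k))
    convert this using 2
    · rw [hg, map_sub, map_smul, neg_smul, sub_eq_add_neg]
    · rw [hg, map_sub, map_smul]; congr 1; module
  have h2 : HasTrace (Ioo a b) g.deriv e 0 := by
    have h3 := sinhElem_deriv_hasTrace (a := a) (b := b) (e := e) k e
    rw [sub_self, Complex.ofReal_zero, mul_zero, Complex.cosh_zero] at h3
    have := hc.add (h3.smul (-c))
    rw [smul_eq_mul, mul_one, add_neg_cancel] at this
    refine this.congr measurableSet_Ioo ?_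
    rw [hg, map_sub, map_smul, sub_eq_add_neg, ← neg_smul]
    filter_upwards [Lp.coeFn_add f.deriv (-c • (sinhElem a b e k).deriv),
      Lp.coeFn_smul (-c) (sinhElem a b e k).deriv] with x h1 h2
    rw [h1, Pi.add_apply, Pi.add_apply, h2]
  obtain ⟨χ, hχ1, hχ2⟩ := eq_of_hasWeakDerivOn_of_hasTrace h1 h2
  have h4 : χ + k • g = 0 := firstOrder_injective k (by
    rw [firstOrder_apply, map_add, map_add, map_smul, map_smul, hχ1, hχ2]
    module)
  have h5 : g = 0 := firstOrder_injective (-k) (by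
    have : (χ + k • g).toL2 = 0 := by rw [h4, map_zero]
    rw [map_add, map_smul, hχ1] at this
    rw [firstOrder_apply, neg_smul, sub_neg_eq_add, this])
  exact sub_eq_zero.1 h5

end H1

end SobolevSolvers

/-! ### The convolution estimate -/

section Convolution

theorem lintegral_mul_sq_le {α : Type*} [MeasurableSpace α] {μ : Measure α} {f g : α → ℝ≥0∞}
    (hf : AEMeasurable f μ) (hg : AEMeasurable g μ) :
    (∫⁻ x, f x * g x ∂μ) ^ 2 ≤ (∫⁻ x, f x ^ 2 ∂μ) * ∫⁻ x, g x ^ 2 ∂μ := by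
  have h := ENNReal.lintegral_mul_le_Lp_mul_Lq μ Real.HolderConjugate.two_two hf hg
  have h2 : ∀ x : ℝ≥0∞, (x ^ (1 / 2 : ℝ)) ^ 2 = x := fun x => by
    rw [← ENNReal.rpow_natCast, ← ENNReal.rpow_mul]; norm_num
  refine (pow_le_pow_left' h 2).trans (le_of_eq ?_)
  rw [mul_pow, h2, h2]
  norm_cast

/-- The kernel `e^{-au}` on `(0,∞)`, extended by zero. -/
def expKernel (a u : ℝ) : ℝ≥0∞ := (Ioi 0).indicator (fun u => ENNReal.ofReal (Real.exp (-a * u))) u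

theorem measurable_expKernel (a : ℝ) : Measurable (expKernel a) :=
  Measurable.indicator (by fun_prop) measurableSet_Ioi

theorem expKernel_sq (a u : ℝ) : expKernel (a / 2) u ^ 2 = expKernel a u := by
  by_cases h : u ∈ Ioi (0 : ℝ)
  · rw [expKernel, expKernel, indicator_of_mem h, indicator_of_mem h,
      ← ENNReal.ofReal_pow (Real.exp_nonneg _), ← Real.exp_nat_mul]
    congr 2
    push_cast
    ring
  · rw [expKernel, expKernel, indicator_of_notMem h, indicator_of_notMem h]
    norm_num

theorem lintegral_expKernel {a : ℝ} (ha : 0 < a) : ∫⁻ u, expKernel a u = ENNReal.ofReal (1 / a) := by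
  have h : -a < 0 := by linarith
  simp only [expKernel]
  rw [lintegral_indicator measurableSet_Ioi,
    ← ofReal_integral_eq_lintegral_ofReal (integrableOn_exp_mul_Ioi h 0)
      (ae_of_all _ fun _ => Real.exp_nonneg _), integral_exp_mul_Ioi h]
  simp

theorem lintegral_expKernel_conv {a : ℝ} (ha : 0 < a) {Y : ℝ → ℝ≥0∞} (hY : AEMeasurable Y) :
    ∫⁻ s, ∫⁻ r, expKernel a (s - r) * Y r = ENNReal.ofReal (1 / a) * ∫⁻ r, Y r := by
  have hm : Measurable fun z : ℝ × ℝ => expKernel a (z.1 - z.2) :=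
    (measurable_expKernel a).comp (measurable_fst.sub measurable_snd)
  rw [lintegral_lintegral_swap (hm.aemeasurable.mul hY.comp_snd),
    ← lintegral_const_mul'' _ hY]
  refine lintegral_congr fun r => ?_
  have hm' : Measurable fun s => expKernel a (s - r) :=
    (measurable_expKernel a).comp (measurable_id.sub_const r)
  rw [lintegral_mul_const _ hm',
    lintegral_sub_right_eq_self (expKernel a) r, lintegral_expKernel ha]

end Convolution

/-! ### The support of the kernel -/

namespace MemoryKernel

variable (K : MemoryKernel)

theorem mem_support_of_le {s r : ℝ} (hs : s ∈ K.support) (hr : 0 < r) (hrs : r ≤ s) :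
    r ∈ K.support :=
  ⟨hr, hs.2.trans_le (K.antitoneOn hr hs.1 hrs)⟩

theorem Ioo_subset_support {s : ℝ} (hs : s ∈ K.support) : Ioo 0 s ⊆ K.support :=
  fun _ hr => K.mem_support_of_le hs hr.1 hr.2.le

theorem nonempty_support : K.support.Nonempty := by
  by_contra h
  rw [not_nonempty_iff_eq_empty] at h
  have h0 : ∀ s, 0 < s → K.μ s = 0 := fun s hs =>
    le_antisymm (not_lt.1 fun h1 => by
      have : s ∈ K.support := ⟨hs, h1⟩
      rw [h] at this; exact this) (K.nonneg s hs)
  have h1 := K.unit_mass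
  rw [setIntegral_eq_zero_of_forall_eq_zero] at h1
  · exact zero_ne_one h1
  · intro s hs
    exact setIntegral_eq_zero_of_forall_eq_zero fun r hr => h0 r (lt_trans hs hr)

theorem exists_support_gt {s : ℝ} (hs : s ∈ K.support) : ∃ q ∈ K.support, s < q := by
  obtain ⟨ε, hε, h⟩ := Metric.isOpen_iff.1 K.isOpen_support s hs
  refine ⟨s + ε / 2, h ?_, by linarith⟩
  rw [Metric.mem_ball, Real.dist_eq, add_sub_cancel_left, abs_of_pos (by linarith)]
  linarith

theorem exists_Ioo_of_isCompact {A : Set ℝ} (hA : A ⊆ K.support) (hc : IsCompact A) :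
    ∃ q ∈ K.support, A ⊆ Ioo 0 q := by
  rcases A.eq_empty_or_nonempty with rfl | hne
  · obtain ⟨q, hq⟩ := K.nonempty_support
    exact ⟨q, hq, empty_subset _⟩
  · obtain ⟨p, hp, hp'⟩ := hc.exists_isGreatest hne
    obtain ⟨q, hq, hpq⟩ := K.exists_support_gt (hA hp)
    exact ⟨q, hq, fun x hx => ⟨(hA hx).1, (hp' hx).trans_lt hpq⟩⟩

theorem volume_restrict_support_ac : volume.restrict K.support ≪ K.measure := by
  intro A hA
  rw [measure_eq_zero_iff_ae_notMem] at hA ⊢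
  exact K.ae_iff.1 hA

theorem measure_ac : K.measure ≪ volume.restrict K.support := by
  intro A hA
  rw [measure_eq_zero_iff_ae_notMem] at hA ⊢
  exact K.ae_iff.2 hA

theorem integral_measure {V : Type*} [NormedAddCommGroup V] [NormedSpace ℝ V] (f : ℝ → V) :
    ∫ s, f s ∂K.measure = ∫ s in Ioi 0, K.μ s • f s := by
  rw [MemoryKernel.measure, integral_withDensity_eq_integral_toReal_smul₀
    K.integrableOn.1.aemeasurable.ennreal_ofReal (ae_of_all _ fun _ => ENNReal.ofReal_lt_top)]
  refine setIntegral_congr_fun measurableSet_Ioi fun s hs => ?_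
  simp only [ENNReal.toReal_ofReal (K.nonneg s hs)]

theorem lintegral_measure {f : ℝ → ℝ≥0∞} (hf : AEMeasurable f K.measure) :
    ∫⁻ s, f s ∂K.measure = ∫⁻ s in Ioi 0, ENNReal.ofReal (K.μ s) * f s := by
  rw [MemoryKernel.measure, lintegral_withDensity_eq_lintegral_mul₀'
    K.integrableOn.1.aemeasurable.ennreal_ofReal hf]
  rfl

/-- As `μ` is bounded below on `(0,q)`, the elements of the memory space are integrable there. -/
theorem integrableOn_of_integrable {V : Type*} [NormedAddCommGroup V] [NormedSpace ℝ V]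
    {f : ℝ → V} (hf : Integrable f K.measure) {q : ℝ} (hq : q ∈ K.support) :
    IntegrableOn f (Ioo 0 q) := by
  have h1 := (integrable_withDensity_iff_integrable_smul₀'
    K.integrableOn.1.aemeasurable.ennreal_ofReal (ae_of_all _ fun _ => ENNReal.ofReal_lt_top)).1 hf
  have h2 : IntegrableOn (fun s => (ENNReal.ofReal (K.μ s)).toReal • f s) (Ioo 0 q) :=
    h1.mono_measure (Measure.restrict_mono Ioo_subset_Ioi_self le_rfl)
  refine (h2.smul (K.μ q)⁻¹).mono ((hf.1.mono_ac K.volume_restrict_support_ac).mono_measure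
    (Measure.restrict_mono (K.Ioo_subset_support hq) le_rfl)) ?_
  filter_upwards [ae_restrict_mem measurableSet_Ioo] with s hs
  simp only [Pi.smul_apply]
  rw [ENNReal.toReal_ofReal (K.nonneg s hs.1), norm_smul, norm_smul, ← mul_assoc]
  refine le_mul_of_one_le_left (norm_nonneg _) ?_
  have h3 : K.μ q ≤ K.μ s := K.antitoneOn hs.1 hq.1 hs.2.le
  rw [Real.norm_of_nonneg (inv_nonneg.2 hq.2.le), Real.norm_of_nonneg (K.nonneg s hs.1),
    inv_mul_eq_div, one_le_div hq.2]
  exact h3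

end MemoryKernel

/-! ### The equation `η' + λ η = ξ` in the memory space -/

section MemorySolution

variable {V : Type*} [NormedAddCommGroup V] [NormedSpace ℂ V]

/-- The function `s ↦ ∫_0^s e^{-λ(s-r)} ξ(r) dr`, i.e. the solution of `η' + λ η = ξ`,
`η(0) = 0`. -/
def memorySol (lam : ℂ) (ξ : ℝ → V) (s : ℝ) : V :=
  Complex.exp (-lam * s) • ∫ r in (0 : ℝ)..s, Complex.exp (lam * r) • ξ r

theorem integrableOn_exp_smul {lam : ℂ} {ξ : ℝ → V} {q : ℝ} (h : IntegrableOn ξ (Ioo 0 q)) :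
    IntegrableOn (fun r : ℝ => Complex.exp (lam * r) • ξ r) (Ioo 0 q) := by
  have h1 : IntegrableOn ξ (Icc 0 q) := (integrableOn_Icc_iff_integrableOn_Ioo).2 h
  exact (h1.continuousOn_smul (contDiff_exp_mul lam).continuous.continuousOn
    isCompact_Icc).mono_set Ioo_subset_Icc_self

theorem intervalIntegrable_exp_smul {lam : ℂ} {ξ : ℝ → V} {q : ℝ} (hq : 0 ≤ q)
    (h : IntegrableOn ξ (Ioo 0 q)) :
    IntervalIntegrable (fun r : ℝ => Complex.exp (lam * r) • ξ r) volume 0 q := by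
  rw [intervalIntegrable_iff_integrableOn_Ioo_of_le hq]
  exact integrableOn_exp_smul h

theorem memorySol_add {lam : ℂ} {ξ ζ : ℝ → V} {s : ℝ} (hs : 0 ≤ s) (h1 : IntegrableOn ξ (Ioo 0 s))
    (h2 : IntegrableOn ζ (Ioo 0 s)) :
    memorySol lam (ξ + ζ) s = memorySol lam ξ s + memorySol lam ζ s := by
  simp only [memorySol, Pi.add_apply, smul_add]
  rw [intervalIntegral.integral_add (intervalIntegrable_exp_smul hs h1)
    (intervalIntegrable_exp_smul hs h2), smul_add]

theorem memorySol_smul (lam c : ℂ) (ξ : ℝ → V) (s : ℝ) :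
    memorySol lam (c • ξ) s = c • memorySol lam ξ s := by
  simp only [memorySol, Pi.smul_apply]
  rw [smul_comm c]
  congr 1
  rw [← intervalIntegral.integral_smul]
  exact intervalIntegral.integral_congr fun r _ => smul_comm (Complex.exp (lam * r)) c (ξ r)

theorem memorySol_const [CompleteSpace V] (lam : ℂ) (x : V) (s : ℝ) :
    memorySol lam (fun _ => x) s = memorySol lam (fun _ => (1 : ℂ)) s • x := by
  simp only [memorySol, smul_eq_mul, mul_one]
  rw [intervalIntegral.integral_smul_const, mul_smul]

theorem memorySol_congr (K : MemoryKernel) (lam : ℂ) {ξ ζ : ℝ → V} (h : ξ =ᵐ[K.measure] ζ) {s : ℝ}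
    (hs : s ∈ K.support) : memorySol lam ξ s = memorySol lam ζ s := by
  have h1 : ∀ᵐ r ∂volume.restrict (Ioo 0 s), ξ r = ζ r :=
    ae_mono (Measure.restrict_mono (K.Ioo_subset_support hs) le_rfl) (K.ae_iff.1 h)
  simp only [memorySol]
  rw [intervalIntegral.integral_of_le hs.1.le, intervalIntegral.integral_of_le hs.1.le,
    integral_Ioc_eq_integral_Ioo, integral_Ioc_eq_integral_Ioo]
  congr 1
  exact integral_congr_ae (by filter_upwards [h1] with r hr; rw [hr])

/-- The pointwise estimate behind the boundedness of the resolvent: the exponential weight is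
split evenly by the Cauchy–Schwarz inequality, and the decay of `μ` outweighs the growth of
`e^{-λ(s-r)}`. -/
theorem memorySol_enorm_sq_le {K : MemoryKernel} {C δ : ℝ} (hC : 0 ≤ C)
    (hμ : ∀ t s : ℝ, 0 ≤ t → 0 < s → K.μ (t + s) ≤ C * Real.exp (-δ * t) * K.μ s)
    {lam : ℂ} {a : ℝ} (ha : a = lam.re + δ / 2) (ha0 : 0 < a) {ξ : ℝ → V}
    (hξ : StronglyMeasurable ξ) {s : ℝ} (hs : 0 < s) :
    ENNReal.ofReal (K.μ s) * ‖memorySol lam ξ s‖ₑ ^ 2 ≤ ENNReal.ofReal (C / a) *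
      ∫⁻ r, expKernel a (s - r) *
        (Ioi 0).indicator (fun r => ENNReal.ofReal (K.μ r) * ‖ξ r‖ₑ ^ 2) r := by
  set g : ℝ → ℝ≥0∞ := (Ioo 0 s).indicator
    fun r => ENNReal.ofReal (Real.exp (-(lam.re - a / 2) * (s - r))) * ‖ξ r‖ₑ with hg
  have mg : Measurable g := Measurable.indicator (by
    have := hξ.enorm
    fun_prop) measurableSet_Ioo
  have mf : Measurable fun r => expKernel (a / 2) (s - r) :=
    (measurable_expKernel _).comp (measurable_const.sub measurable_id)
  have h1 : ‖memorySol lam ξ s‖ₑ ≤ ∫⁻ r, expKernel (a / 2) (s - r) * g r := by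
    have e1 : ∀ (c : ℂ) (r : ℝ), ‖Complex.exp (c * r)‖ₑ = ENNReal.ofReal (Real.exp (c.re * r)) := by
      intro c r
      rw [← ofReal_norm, Complex.norm_exp]
      simp
    rw [memorySol, enorm_smul, intervalIntegral.integral_of_le hs.le, integral_Ioc_eq_integral_Ioo]
    refine (mul_le_mul_right (enorm_integral_le_lintegral_enorm _) _).trans (le_of_eq ?_)
    rw [← lintegral_const_mul' _ _ enorm_ne_top, ← lintegral_indicator measurableSet_Ioo]
    refine lintegral_congr fun r => ?_
    by_cases hr : r ∈ Ioo 0 s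
    · rw [hg, indicator_of_mem hr, indicator_of_mem hr, expKernel,
        indicator_of_mem (show s - r ∈ Ioi 0 from sub_pos.2 hr.2), enorm_smul, e1, e1,
        ← mul_assoc, ← mul_assoc, ← ENNReal.ofReal_mul (Real.exp_nonneg _),
        ← ENNReal.ofReal_mul (Real.exp_nonneg _), ← Real.exp_add, ← Real.exp_add]
      congr 3
      simp only [Complex.neg_re]
      ring
    · rw [hg, indicator_of_notMem hr, indicator_of_notMem hr, mul_zero]
  have h2 : ∫⁻ r, expKernel (a / 2) (s - r) ^ 2 = ENNReal.ofReal (1 / a) := by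
    simp only [expKernel_sq]
    rw [lintegral_sub_left_eq_self (expKernel a) s, lintegral_expKernel ha0]
  have h3 : ENNReal.ofReal (K.μ s) * ∫⁻ r, g r ^ 2 ≤ ENNReal.ofReal C * ∫⁻ r, expKernel a (s - r) *
        (Ioi 0).indicator (fun r => ENNReal.ofReal (K.μ r) * ‖ξ r‖ₑ ^ 2) r := by
    rw [← lintegral_const_mul' _ _ ENNReal.ofReal_ne_top,
      ← lintegral_const_mul' _ _ ENNReal.ofReal_ne_top]
    refine lintegral_mono fun r => ?_
    by_cases hr : r ∈ Ioo 0 s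
    · simp only [hg]
      rw [indicator_of_mem hr, indicator_of_mem (show r ∈ Ioi 0 from hr.1), expKernel,
        indicator_of_mem (show s - r ∈ Ioi 0 from sub_pos.2 hr.2), mul_pow, ← mul_assoc,
        ← mul_assoc, ← mul_assoc, ← ENNReal.ofReal_pow (Real.exp_nonneg _),
        ← ENNReal.ofReal_mul' (by positivity), ← ENNReal.ofReal_mul hC,
        ← ENNReal.ofReal_mul (by positivity)]
      refine mul_le_mul_left (ENNReal.ofReal_le_ofReal ?_) _
      have h4 := hμ (s - r) r (sub_nonneg.2 hr.2.le) hr.1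
      rw [sub_add_cancel] at h4
      refine (mul_le_mul_of_nonneg_right h4 (by positivity)).trans (le_of_eq ?_)
      rw [← Real.exp_nat_mul, mul_right_comm, mul_assoc C, ← Real.exp_add]
      congr 3
      rw [ha]
      push_cast
      ring
    · simp [hg, indicator_of_notMem hr]
  calc ENNReal.ofReal (K.μ s) * ‖memorySol lam ξ s‖ₑ ^ 2
      ≤ ENNReal.ofReal (K.μ s) * (ENNReal.ofReal (1 / a) * ∫⁻ r, g r ^ 2) := by
        refine mul_le_mul_right ((pow_le_pow_left' h1 2).trans ?_) _
        rw [← h2]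
        exact lintegral_mul_sq_le mf.aemeasurable mg.aemeasurable
    _ = ENNReal.ofReal (1 / a) * (ENNReal.ofReal (K.μ s) * ∫⁻ r, g r ^ 2) := mul_left_comm _ _ _
    _ ≤ _ := by
        refine (mul_le_mul_right h3 _).trans (le_of_eq ?_)
        rw [← mul_assoc, ← ENNReal.ofReal_mul (by positivity)]
        congr 2
        ring

variable [CompleteSpace V]

theorem memorySol_hasWeakDerivOn_Ioo {lam : ℂ} {ξ : ℝ → V} {q : ℝ}
    (h : IntegrableOn ξ (Ioo 0 q)) :
    HasWeakDerivOn (Ioo 0 q) (memorySol lam ξ) (fun s => -lam • memorySol lam ξ s + ξ s) ∧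
      HasTrace (Ioo 0 q) (memorySol lam ξ) 0 0 := by
  set w := (Ioo 0 q).indicator fun r : ℝ => Complex.exp (lam * r) • ξ r with hw
  have iw : Integrable w := (integrable_indicator_iff measurableSet_Ioo).2 (integrableOn_exp_smul h)
  have hF : ∀ x ∈ Ioo 0 q, memorySol lam ξ x = Complex.exp (-lam * x) • ∫ t in (0 : ℝ)..x, w t := by
    intro x hx
    rw [memorySol]
    congr 1
    rw [intervalIntegral.integral_of_le hx.1.le, intervalIntegral.integral_of_le hx.1.le]
    refine setIntegral_congr_fun measurableSet_Ioc fun t ht => ?_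
    simp only [hw]
    rw [indicator_of_mem (show t ∈ Ioo 0 q from ⟨ht.1, ht.2.trans_lt hx.2⟩)]
  have hF' : (fun x : ℝ => Complex.exp (-lam * x) • ∫ t in (0 : ℝ)..x, w t)
      =ᵐ[volume.restrict (Ioo 0 q)] memorySol lam ξ := by
    filter_upwards [ae_restrict_mem measurableSet_Ioo] with x hx using (hF x hx).symm
  have hcont : Continuous fun x => ∫ t in (0 : ℝ)..x, w t :=
    intervalIntegral.continuous_primitive (fun _ _ => iw.intervalIntegrable) 0
  constructor
  · refine ((hasWeakDerivOn_primitive 0 iw).contDiff_smul isOpen_Ioo (contDiff_exp_mul (-lam))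
      (hasDerivAt_exp_mul (-lam))).congr hF' ?_
    filter_upwards [ae_restrict_mem measurableSet_Ioo] with x hx
    rw [hF x hx, hw, indicator_of_mem hx, smul_smul (Complex.exp _) (Complex.exp _),
      ← Complex.exp_add, mul_smul]
    simp
  · have h0 := hasTrace_of_continuousAt (U := Ioo 0 q) (e := 0)
      ((contDiff_exp_mul (-lam)).continuous.smul hcont).continuousAt
    have h1 : HasTrace (Ioo 0 q) (memorySol lam ξ) 0
        (Complex.exp (-lam * (0 : ℝ)) • ∫ t in (0 : ℝ)..0, w t) := h0.congr measurableSet_Ioo hF'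
    rwa [intervalIntegral.integral_same, smul_zero] at h1

variable (K : MemoryKernel)

theorem memorySol_hasWeakDerivOn {lam : ℂ} {ξ : ℝ → V} (hξ : Integrable ξ K.measure) :
    HasWeakDerivOn K.support (memorySol lam ξ) (fun s => -lam • memorySol lam ξ s + ξ s) := by
  refine HasWeakDerivOn.of_compact_exhaustion fun A hA hc => ?_
  obtain ⟨q, hq, hAq⟩ := K.exists_Ioo_of_isCompact hA hc
  exact ⟨_, isOpen_Ioo, hAq, K.Ioo_subset_support hq,
    (memorySol_hasWeakDerivOn_Ioo (K.integrableOn_of_integrable hξ hq)).1⟩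

theorem memorySol_hasTrace {lam : ℂ} {ξ : ℝ → V} (hξ : Integrable ξ K.measure) :
    HasTrace K.support (memorySol lam ξ) 0 0 := by
  obtain ⟨q, hq⟩ := K.nonempty_support
  have h := (memorySol_hasWeakDerivOn_Ioo (lam := lam) (K.integrableOn_of_integrable hξ hq)).2
  refine Tendsto.mono_left h (inf_le_inf_right _ (nhdsWithin_le_of_mem ?_))
  filter_upwards [self_mem_nhdsWithin, nhdsWithin_le_nhds (Iio_mem_nhds hq.1)] with x hx hx'
    using ⟨hx.1, hx'⟩

theorem memorySol_aestronglyMeasurable {lam : ℂ} {ξ : ℝ → V} (hξ : Integrable ξ K.measure) :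
    AEStronglyMeasurable (memorySol lam ξ) K.measure :=
  (memorySol_hasWeakDerivOn K hξ).1.aestronglyMeasurable.mono_ac K.measure_ac

variable {K}

theorem lintegral_memorySol_sq_le {C δ : ℝ} (hC : 0 ≤ C)
    (hμ : ∀ t s : ℝ, 0 ≤ t → 0 < s → K.μ (t + s) ≤ C * Real.exp (-δ * t) * K.μ s)
    {lam : ℂ} {a : ℝ} (ha : a = lam.re + δ / 2) (ha0 : 0 < a) {ξ : ℝ → V}
    (hξ : StronglyMeasurable ξ) (hi : Integrable ξ K.measure) :
    ∫⁻ s, ‖memorySol lam ξ s‖ₑ ^ 2 ∂K.measure ≤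
      ENNReal.ofReal (C / a ^ 2) * ∫⁻ s, ‖ξ s‖ₑ ^ 2 ∂K.measure := by
  have m1 := (memorySol_aestronglyMeasurable (lam := lam) K hi).enorm.pow_const 2
  have m2 : AEMeasurable ((Ioi 0).indicator fun r => ENNReal.ofReal (K.μ r) * ‖ξ r‖ₑ ^ 2) := by
    rw [aemeasurable_indicator_iff measurableSet_Ioi]
    exact K.integrableOn.1.aemeasurable.ennreal_ofReal.mul (hξ.enorm.pow_const 2).aemeasurable
  rw [K.lintegral_measure m1, K.lintegral_measure (hξ.enorm.pow_const 2).aemeasurable]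
  calc ∫⁻ s in Ioi 0, ENNReal.ofReal (K.μ s) * ‖memorySol lam ξ s‖ₑ ^ 2
      ≤ ∫⁻ s in Ioi 0, ENNReal.ofReal (C / a) * ∫⁻ r, expKernel a (s - r) *
        (Ioi 0).indicator (fun r => ENNReal.ofReal (K.μ r) * ‖ξ r‖ₑ ^ 2) r :=
        setLIntegral_mono' measurableSet_Ioi fun s hs =>
          memorySol_enorm_sq_le hC hμ ha ha0 hξ hs
    _ ≤ ∫⁻ s, ENNReal.ofReal (C / a) * ∫⁻ r, expKernel a (s - r) *
        (Ioi 0).indicator (fun r => ENNReal.ofReal (K.μ r) * ‖ξ r‖ₑ ^ 2) r :=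
        setLIntegral_le_lintegral _ _
    _ = _ := by
        rw [lintegral_const_mul' _ _ ENNReal.ofReal_ne_top, lintegral_expKernel_conv ha0 m2,
          lintegral_indicator measurableSet_Ioi, ← mul_assoc, ← ENNReal.ofReal_mul (by positivity)]
        congr 2
        field_simp

theorem eLpNorm_memorySol_le {C δ : ℝ} (hC : 0 ≤ C)
    (hμ : ∀ t s : ℝ, 0 ≤ t → 0 < s → K.μ (t + s) ≤ C * Real.exp (-δ * t) * K.μ s)
    {lam : ℂ} {a : ℝ} (ha : a = lam.re + δ / 2) (ha0 : 0 < a) {ξ : ℝ → V}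
    (hξ : StronglyMeasurable ξ) (hi : Integrable ξ K.measure) :
    eLpNorm (memorySol lam ξ) 2 K.measure ≤
      ENNReal.ofReal (C / a ^ 2) ^ (1 / 2 : ℝ) * eLpNorm ξ 2 K.measure := by
  have h := lintegral_memorySol_sq_le hC hμ ha ha0 hξ hi
  rw [eLpNorm_eq_lintegral_rpow_enorm_toReal (by norm_num) (by norm_num),
    eLpNorm_eq_lintegral_rpow_enorm_toReal (by norm_num) (by norm_num),
    ENNReal.toReal_ofNat, ← ENNReal.mul_rpow_of_nonneg _ _ (by norm_num)]
  refine ENNReal.rpow_le_rpow ?_ (by norm_num)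
  exact_mod_cast h

end MemorySolution

/-! ### The resolvent of the translation generator -/

section MemoryResolvent

variable {K : MemoryKernel}

theorem Memory.integrable (ξ : Memory K) : Integrable ξ K.measure :=
  (Lp.memLp ξ).integrable (by norm_num)

theorem memLp_memorySol {C δ : ℝ} (hC : 0 ≤ C)
    (hμ : ∀ t s : ℝ, 0 ≤ t → 0 < s → K.μ (t + s) ≤ C * Real.exp (-δ * t) * K.μ s)
    {lam : ℂ} (hlam : 0 < lam.re + δ / 2) (ξ : Memory K) : MemLp (memorySol lam ξ) 2 K.measure :=
  ⟨memorySol_aestronglyMeasurable K ξ.integrable,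
    (eLpNorm_memorySol_le hC hμ rfl hlam (Lp.stronglyMeasurable ξ) ξ.integrable).trans_lt
      (ENNReal.mul_lt_top (ENNReal.rpow_lt_top_of_nonneg (by norm_num) ENNReal.ofReal_ne_top)
        (Lp.eLpNorm_lt_top ξ))⟩

/-- The resolvent `(λ - T)⁻¹` of the translation generator, for `Re λ > -δ/2`. -/
def memoryResolvent {C δ : ℝ} (hC : 0 ≤ C)
    (hμ : ∀ t s : ℝ, 0 ≤ t → 0 < s → K.μ (t + s) ≤ C * Real.exp (-δ * t) * K.μ s)
    {lam : ℂ} (hlam : 0 < lam.re + δ / 2) : Memory K →L[ℂ] Memory K :=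
  LinearMap.mkContinuous
    { toFun := fun ξ => (memLp_memorySol hC hμ hlam ξ).toLp _
      map_add' := fun ξ ζ => by
        refine (MemLp.toLp_congr _ ((memLp_memorySol hC hμ hlam ξ).add
          (memLp_memorySol hC hμ hlam ζ)) (K.ae_iff.2 ?_)).trans (MemLp.toLp_add _ _)
        filter_upwards [ae_restrict_mem K.isOpen_support.measurableSet] with s hs
        rw [memorySol_congr K lam (Lp.coeFn_add ξ ζ) hs, Pi.add_apply,
          memorySol_add hs.1.le (K.integrableOn_of_integrable ξ.integrable hs)
            (K.integrableOn_of_integrable ζ.integrable hs)]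
      map_smul' := fun c ξ => by
        refine (MemLp.toLp_congr _ ((memLp_memorySol hC hμ hlam ξ).const_smul c)
          (K.ae_iff.2 ?_)).trans (MemLp.toLp_const_smul _ _)
        filter_upwards [ae_restrict_mem K.isOpen_support.measurableSet] with s hs
        rw [memorySol_congr K lam (Lp.coeFn_smul c ξ) hs, Pi.smul_apply, memorySol_smul] }
    (ENNReal.ofReal (C / (lam.re + δ / 2) ^ 2) ^ (1 / 2 : ℝ)).toReal
    fun ξ => by
      change ‖(memLp_memorySol hC hμ hlam ξ).toLp _‖ ≤ _
      rw [Lp.norm_toLp, Lp.norm_def, ← ENNReal.toReal_mul]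
      exact ENNReal.toReal_mono (ENNReal.mul_ne_top
        (ENNReal.rpow_ne_top_of_nonneg (by norm_num) ENNReal.ofReal_ne_top) (Lp.eLpNorm_ne_top ξ))
        (eLpNorm_memorySol_le hC hμ rfl hlam (Lp.stronglyMeasurable ξ) ξ.integrable)

variable {C δ : ℝ} {hC : 0 ≤ C}
  {hμ : ∀ t s : ℝ, 0 ≤ t → 0 < s → K.μ (t + s) ≤ C * Real.exp (-δ * t) * K.μ s}
  {lam : ℂ} {hlam : 0 < lam.re + δ / 2}

theorem memoryResolvent_coeFn (ξ : Memory K) :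
    memoryResolvent hC hμ hlam ξ =ᵐ[K.measure] memorySol lam ξ :=
  (memLp_memorySol hC hμ hlam ξ).coeFn_toLp

theorem memoryResolvent_mem_graph (ξ : Memory K) :
    (memoryResolvent hC hμ hlam ξ, lam • memoryResolvent hC hμ hlam ξ - ξ) ∈
      (translationGenerator K).graph := by
  rw [mem_translationGenerator_graph]
  have h1 := K.ae_iff.1 (memoryResolvent_coeFn (hC := hC) (hμ := hμ) (hlam := hlam) ξ).symm
  refine ⟨(memorySol_hasWeakDerivOn K ξ.integrable).congr h1 ?_,
    (memorySol_hasTrace K ξ.integrable).congr K.isOpen_support.measurableSet h1⟩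
  set η := memoryResolvent hC hμ hlam ξ
  have e : -(lam • η - ξ) = -lam • η + ξ := by module
  rw [e]
  filter_upwards [h1, K.ae_iff.1 (Lp.coeFn_add (-lam • η) ξ), K.ae_iff.1 (Lp.coeFn_smul (-lam) η)]
    with s h1 h2 h3
  rw [h2, Pi.add_apply, h3, Pi.smul_apply, h1]

/-- The translation generator has no eigenvalues: this is uniqueness for the initial value problem
`η' = -λ η`, `η(0) = 0`, on every interval `(0,q)` inside the support of `μ`. -/
theorem translationGenerator_eigen_eq_zero {η : Memory K}
    (h : (η, lam • η) ∈ (translationGenerator K).graph) : η = 0 := by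
  rw [mem_translationGenerator_graph] at h
  obtain ⟨h1, h2⟩ := h
  have e : (-(lam • η) : Memory K) = -lam • η := by rw [neg_smul]
  have h1' : HasWeakDerivOn K.support η fun s => -lam • η s := by
    refine h1.congr (ae_eq_refl _) ?_
    change ⇑(-(lam • η) : Memory K) =ᵐ[_] _
    rw [e]
    exact K.ae_iff.1 (Lp.coeFn_smul (-lam) η)
  refine Lp.ext (EventuallyEq.trans (g := (0 : ℝ → H1r)) (K.ae_iff.2 ?_) (Lp.coeFn_zero _ _ _).symm)
  rw [ae_restrict_iff' K.isOpen_support.measurableSet, ae_iff]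
  refine measure_null_of_locally_null _ fun s hs => ?_
  simp only [Pi.zero_apply, mem_ofPred_eq, Classical.not_imp] at hs
  obtain ⟨q, hq, hsq⟩ := K.exists_support_gt hs.1
  have h3 := (h1'.mono (K.Ioo_subset_support hq)).ae_eq_zero_of_smul hq.1 ⟨le_rfl, hq.1.le⟩ (-lam)
    (h2.mono (K.Ioo_subset_support hq))
  rw [EventuallyEq, ae_restrict_iff' measurableSet_Ioo, ae_iff] at h3
  refine ⟨_, inter_mem self_mem_nhdsWithin
    (nhdsWithin_le_nhds (Ioo_mem_nhds hs.1.1 hsq)), measure_mono_null ?_ h3⟩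
  rintro x ⟨hx, hx'⟩
  simp only [Pi.zero_apply, mem_ofPred_eq, Classical.not_imp] at hx ⊢
  exact ⟨hx', hx.2⟩

theorem eq_memoryResolvent {η ξ : Memory K}
    (h : (η, lam • η - ξ) ∈ (translationGenerator K).graph) : η = memoryResolvent hC hμ hlam ξ := by
  have h1 := (translationGenerator K).graph.sub_mem h
    (memoryResolvent_mem_graph (hC := hC) (hμ := hμ) (hlam := hlam) ξ)
  refine sub_eq_zero.1 (translationGenerator_eigen_eq_zero (lam := lam) ?_)
  convert h1 using 1
  refine Prod.ext rfl ?_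
  change lam • (η - _) = (lam • η - ξ) - (lam • _ - ξ)
  module

/-- The number `1 + ∫_0^∞ μ(s) κ(s) ds`, `κ(s) = ∫_0^s e^{-λ(s-r)} dr`; it is `ℓ(λ)` for `λ ≠ 0`
and extends `ℓ` to `λ = 0`. -/
def MemoryKernel.ellExt (K : MemoryKernel) (lam : ℂ) : ℂ :=
  1 + ∫ s, memorySol lam (fun _ => (1 : ℂ)) s ∂K.measure

theorem integral_memoryResolvent_const (x : H1r) :
    integralL2 H1r K.measure (memoryResolvent hC hμ hlam (Lp.const 2 K.measure x)) =
      (K.ellExt lam - 1) • x := by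
  rw [MemoryKernel.ellExt, add_sub_cancel_left, ← integral_smul_const, integralL2_apply]
  refine integral_congr_ae ((memoryResolvent_coeFn _).trans (K.ae_iff.2 ?_))
  filter_upwards [ae_restrict_mem K.isOpen_support.measurableSet] with s hs
  rw [← memorySol_const, memorySol_congr K lam (Lp.coeFn_const ..) hs]
  rfl

theorem MemoryKernel.ellExt_of_ne_zero (K : MemoryKernel) {lam : ℂ} (h : lam ≠ 0) :
    K.ellExt lam = K.ell lam := by
  rw [MemoryKernel.ellExt, MemoryKernel.ell, K.integral_measure, ← integral_const_mul]
  congr 1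
  refine setIntegral_congr_fun measurableSet_Ioi fun s _ => ?_
  simp only [memorySol, smul_eq_mul, mul_one, Complex.real_smul]
  rw [integral_exp_mul_complex h, Complex.ofReal_zero, mul_zero, Complex.exp_zero, mul_div_assoc',
    mul_sub, ← Complex.exp_add, neg_mul, neg_add_cancel, Complex.exp_zero, mul_one]
  field_simp

/-- At `λ = 0` one has `κ(s) = s`, and `∫ s μ(s) ds = ∫∫_{r > s} μ(r) dr ds = 1` by Tonelli's theorem
and the normalization of the kernel. -/
theorem MemoryKernel.ellExt_zero (K : MemoryKernel) : K.ellExt 0 = 2 := by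
  have h0 : ∫ s, memorySol 0 (fun _ => (1 : ℂ)) s ∂K.measure =
      ((∫ s in Ioi 0, K.μ s * s : ℝ) : ℂ) := by
    rw [K.integral_measure, ← integral_complex_ofReal]
    refine setIntegral_congr_fun measurableSet_Ioi fun s _ => ?_
    simp [memorySol]
  have mμ : AEMeasurable ((Ioi 0).indicator fun r => ENNReal.ofReal (K.μ r)) := by
    rw [aemeasurable_indicator_iff measurableSet_Ioi]
    exact K.integrableOn.1.aemeasurable.ennreal_ofReal
  have hin : ∀ s ∈ Ioi (0 : ℝ), ENNReal.ofReal (∫ r in Ioi s, K.μ r) =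
      ∫⁻ r in Ioi s, ENNReal.ofReal (K.μ r) := fun s hs =>
    ofReal_integral_eq_lintegral_ofReal (K.integrableOn.mono_set (Ioi_subset_Ioi (le_of_lt hs)))
      (by
        filter_upwards [ae_restrict_mem measurableSet_Ioi] with r hr
          using K.nonneg r (lt_trans hs hr))
  have hg : Integrable (fun s => ∫ r in Ioi s, K.μ r) (volume.restrict (Ioi 0)) := by
    by_contra h
    have := K.unit_mass
    rw [integral_undef h] at this
    exact zero_ne_one this
  have h1 : ∫⁻ s in Ioi (0 : ℝ), ∫⁻ r in Ioi s, ENNReal.ofReal (K.μ r) = 1 := by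
    rw [← setLIntegral_congr_fun measurableSet_Ioi hin, ← ofReal_integral_eq_lintegral_ofReal hg,
      K.unit_mass, ENNReal.ofReal_one]
    filter_upwards [ae_restrict_mem measurableSet_Ioi] with s hs
    exact setIntegral_nonneg measurableSet_Ioi fun r hr => K.nonneg r (lt_trans hs hr)
  set Y := (Ioi (0 : ℝ)).indicator fun r => ENNReal.ofReal (K.μ r) with hY
  have h2 : ∫⁻ s in Ioi (0 : ℝ), ENNReal.ofReal (K.μ s * s) = 1 := by
    rw [← h1]
    let F : ℝ × ℝ → ℝ≥0∞ := {z : ℝ × ℝ | 0 < z.1 ∧ z.1 < z.2}.indicator fun z => Y z.2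
    have mF : AEMeasurable F (volume.prod volume) :=
      mμ.comp_snd.indicator ((measurableSet_lt measurable_const measurable_fst).inter
        (measurableSet_lt measurable_fst measurable_snd))
    have e1 : ∀ s ∈ Ioi (0 : ℝ), ∫⁻ r in Ioi s, ENNReal.ofReal (K.μ r) = ∫⁻ r, F (s, r) := by
      intro s hs
      rw [← lintegral_indicator measurableSet_Ioi]
      refine lintegral_congr fun r => ?_
      by_cases hr : r ∈ Ioi s
      · have hr0 : r ∈ Ioi (0 : ℝ) := lt_trans (mem_Ioi.1 hs) (mem_Ioi.1 hr)
        rw [indicator_of_mem hr]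
        simp only [F]
        rw [indicator_of_mem (show (s, r) ∈ {z : ℝ × ℝ | 0 < z.1 ∧ z.1 < z.2} from ⟨hs, hr⟩), hY,
          indicator_of_mem hr0]
      · rw [indicator_of_notMem hr]
        simp only [F]
        rw [indicator_of_notMem fun h => hr h.2]
    have e2 : ∫⁻ s in Ioi (0 : ℝ), ∫⁻ r, F (s, r) = ∫⁻ s, ∫⁻ r, F (s, r) := by
      rw [← lintegral_indicator measurableSet_Ioi]
      refine lintegral_congr fun s => ?_
      by_cases hs : s ∈ Ioi (0 : ℝ)
      · rw [indicator_of_mem hs]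
      · rw [indicator_of_notMem hs]
        have : ∀ r, F (s, r) = 0 := fun r => indicator_of_notMem (fun h => hs h.1) _
        simp [this]
    rw [setLIntegral_congr_fun measurableSet_Ioi e1, e2,
      lintegral_lintegral_swap (f := fun s r => F (s, r)) mF,
      ← lintegral_indicator measurableSet_Ioi]
    refine lintegral_congr fun r => ?_
    have e3 : ∀ s, F (s, r) = (Ioo 0 r).indicator (fun _ => Y r) s := fun s => by
      by_cases hs : s ∈ Ioo 0 r
      · rw [indicator_of_mem hs]
        exact indicator_of_mem (show (s, r) ∈ {z : ℝ × ℝ | 0 < z.1 ∧ z.1 < z.2} from hs) _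
      · rw [indicator_of_notMem hs]
        exact indicator_of_notMem
          (show (s, r) ∉ {z : ℝ × ℝ | 0 < z.1 ∧ z.1 < z.2} from hs) _
    simp only [e3]
    rw [lintegral_indicator measurableSet_Ioo, setLIntegral_const, Real.volume_Ioo, sub_zero]
    by_cases hr : r ∈ Ioi (0 : ℝ)
    · rw [hY, indicator_of_mem hr, indicator_of_mem hr, ENNReal.ofReal_mul (K.nonneg r hr)]
    · rw [hY, indicator_of_notMem hr, indicator_of_notMem hr, zero_mul]
  have m3 : AEStronglyMeasurable (fun s => K.μ s * s) (volume.restrict (Ioi 0)) :=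
    K.integrableOn.1.mul aestronglyMeasurable_id
  have h3 : ∫ s in Ioi 0, K.μ s * s = 1 := by
    rw [integral_eq_lintegral_of_nonneg_ae _ m3, h2,
      ENNReal.toReal_one]
    filter_upwards [ae_restrict_mem measurableSet_Ioi] with s hs
      using mul_nonneg (K.nonneg s hs) (le_of_lt hs)
  rw [MemoryKernel.ellExt, h0, h3]
  norm_num

end MemoryResolvent

/-! ### Boundary values at the interface -/

section Interface

/-- The boundary value at `0` on `H¹_l(-1,0)`. -/
def traceLeft : H1l →L[ℂ] ℂ :=
  integralL2 ℂ (volume.restrict (Ioo (-1) 0)) ∘L (H1.derivEquiv (-1) 0 (-1) : H1l →L[ℂ] L2 (-1) 0)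

/-- The boundary value at `0` on `H¹_r(0,1)`. -/
def traceRight : H1r →L[ℂ] ℂ :=
  -(integralL2 ℂ (volume.restrict (Ioo 0 1)) ∘L (H1.derivEquiv 0 1 1 : H1r →L[ℂ] L2 0 1))

theorem hasTrace_traceLeft (φ : H1l) : HasTrace (Ioo (-1) 0) φ.toL2 0 (traceLeft φ) := by
  have h := φ.hasTrace_integral 0
  rwa [intervalIntegral.integral_of_le (by norm_num), integral_Ioc_eq_integral_Ioo,
    setIntegral_indicator measurableSet_Ioo, inter_self] at h

theorem hasTrace_traceRight (φ : H1r) : HasTrace (Ioo 0 1) φ.toL2 0 (traceRight φ) := by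
  have h := φ.hasTrace_integral 0
  rwa [intervalIntegral.integral_of_ge (by norm_num), integral_Ioc_eq_integral_Ioo,
    setIntegral_indicator measurableSet_Ioo, inter_self] at h

theorem HasTrace.eq_left {f : ℝ → ℂ} {c d : ℂ} (h1 : HasTrace (Ioo (-1) 0) f 0 c)
    (h2 : HasTrace (Ioo (-1) 0) f 0 d) : c = d :=
  HasTrace.unique (by norm_num) (by norm_num) h1 h2

theorem HasTrace.eq_right {f : ℝ → ℂ} {c d : ℂ} (h1 : HasTrace (Ioo 0 1) f 0 c)
    (h2 : HasTrace (Ioo 0 1) f 0 d) : c = d :=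
  HasTrace.unique (by norm_num) (by norm_num) h1 h2

theorem traceLeft_sinhElem (k : ℂ) : traceLeft (H1.sinhElem (-1) 0 (-1) k) = sinhDiv k 1 := by
  have h := HasTrace.eq_left (hasTrace_traceLeft _)
    (H1.sinhElem_hasTrace (a := -1) (b := 0) (e := -1) k 0)
  simpa using h

theorem traceRight_sinhElem (k : ℂ) : traceRight (H1.sinhElem 0 1 1 k) = -sinhDiv k 1 := by
  have h := HasTrace.eq_right (hasTrace_traceRight _)
    (H1.sinhElem_hasTrace (a := 0) (b := 1) (e := 1) k 0)
  rwa [zero_sub, sinhDiv_neg] at h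

namespace H1

variable {a b e : ℝ} [Endpoint a b e]

/-- The general solution of `φ'' = k² φ + F`, `φ(e) = 0`, with parameter `c = φ'(e)`. -/
def generalSol (a b e : ℝ) [Endpoint a b e] (k : ℂ) (F : L2 a b) (c : ℂ) : H1 a b e :=
  solveSecond a b e k F + c • sinhElem a b e k

theorem generalSol_deriv (k : ℂ) (F : L2 a b) (c : ℂ) : (generalSol a b e k F c).deriv =
    (solveSecondDeriv a b e k F).toL2 + c • (sinhElem a b e k).deriv := by
  rw [generalSol, map_add, map_smul, deriv_solveSecond]

theorem generalSol_deriv_hasWeakDerivOn (k : ℂ) (F : L2 a b) (c : ℂ) :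
    HasWeakDerivOn (Ioo a b) (generalSol a b e k F c).deriv
      (k ^ 2 • (generalSol a b e k F c).toL2 + F : L2 a b) := by
  rw [generalSol_deriv]
  have := hasWeakDerivOn_L2_add (solveSecondDeriv a b e k F).hasWeakDerivOn
    (hasWeakDerivOn_L2_smul c (sinhElem_deriv_hasWeakDerivOn (e := e) k))
  rw [deriv_solveSecondDeriv] at this
  have e1 : k ^ 2 • (generalSol a b e k F c).toL2 + F =
      k ^ 2 • (solveSecond a b e k F).toL2 + F + c • k ^ 2 • (sinhElem a b e k).toL2 := by
    rw [generalSol, map_add, map_smul]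
    module
  rwa [e1]

theorem generalSol_deriv_hasTrace (k : ℂ) (F : L2 a b) (c : ℂ) {x : ℝ} {t : ℂ}
    (h : HasTrace (Ioo a b) (solveSecondDeriv a b e k F).toL2 x t) :
    HasTrace (Ioo a b) (generalSol a b e k F c).deriv x
      (t + c * Complex.cosh (k * (x - e : ℝ))) := by
  rw [generalSol_deriv]
  refine (h.add ((sinhElem_deriv_hasTrace k x).smul c)).congr measurableSet_Ioo ?_
  filter_upwards [Lp.coeFn_add (solveSecondDeriv a b e k F).toL2 (c • (sinhElem a b e k).deriv),
    Lp.coeFn_smul c (sinhElem a b e k).deriv] with x h1 h2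
  rw [h1, Pi.add_apply, Pi.add_apply, h2]

end H1

end Interface

/-! ### The resolvent equation -/

section ResolventEquation

variable {K : MemoryKernel}

namespace StateSpace

/-- The state with given components. -/
def mk (u : H1l) (v : L2 (-1) 0) (w : L2 0 1) (η : Memory K) : StateSpace K :=
  WithLp.toLp 2 (u, WithLp.toLp 2 (v, WithLp.toLp 2 (w, η)))

variable (K)

/-- The component `u`, as a bounded operator. -/
def uL : StateSpace K →L[ℂ] H1l := WithLp.fstL 2 ℂ _ _

/-- The component `v`, as a bounded operator. -/
def vL : StateSpace K →L[ℂ] L2 (-1) 0 := WithLp.fstL 2 ℂ _ _ ∘L WithLp.sndL 2 ℂ _ _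

/-- The component `w`, as a bounded operator. -/
def wL : StateSpace K →L[ℂ] L2 0 1 :=
  WithLp.fstL 2 ℂ _ _ ∘L WithLp.sndL 2 ℂ _ _ ∘L WithLp.sndL 2 ℂ _ _

/-- The component `η`, as a bounded operator. -/
def ηL : StateSpace K →L[ℂ] Memory K :=
  WithLp.sndL 2 ℂ _ _ ∘L WithLp.sndL 2 ℂ _ _ ∘L WithLp.sndL 2 ℂ _ _

variable {K}

/-- The bounded operator into the state space with given components. -/
def mkL {X : Type*} [NormedAddCommGroup X] [NormedSpace ℂ X] (u : X →L[ℂ] H1l)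
    (v : X →L[ℂ] L2 (-1) 0) (w : X →L[ℂ] L2 0 1) (η : X →L[ℂ] Memory K) : X →L[ℂ] StateSpace K :=
  (WithLp.prodContinuousLinearEquiv 2 ℂ _ _).symm.toContinuousLinearMap ∘L u.prod
    ((WithLp.prodContinuousLinearEquiv 2 ℂ _ _).symm.toContinuousLinearMap ∘L v.prod
      ((WithLp.prodContinuousLinearEquiv 2 ℂ _ _).symm.toContinuousLinearMap ∘L w.prod η))

end StateSpace

theorem mem_resolventSet_systemOperator {lam : ℂ} (R : StateSpace K →L[ℂ] StateSpace K)
    (h1 : ∀ y, IsSystemPair (R y) (lam • R y - y))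
    (h2 : ∀ z : StateSpace K, IsSystemPair z (lam • z) → z = 0) :
    lam ∈ unboundedResolventSet (systemOperator K) := by
  refine ⟨R, fun y => ?_, fun x => ?_⟩
  · obtain ⟨x, hx1, hx2⟩ := (LinearPMap.mem_graph_iff _).1
      ((mem_systemOperator_graph K (R y, lam • R y - y)).2 (h1 y))
    exact ⟨x, hx1, by rw [hx2, hx1]; exact sub_sub_cancel _ _⟩
  · have h3 : IsSystemPair (x : StateSpace K) (systemOperator K x) :=
      (mem_systemOperator_graph K _).1 ((systemOperator K).mem_graph x)
    set y := lam • (x : StateSpace K) - systemOperator K x with hy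
    have h4 := (h1 y).add (h3.smul (-1))
    have h5 := h2 (R y + (-1 : ℂ) • (x : StateSpace K)) (by
      convert h4 using 1
      rw [hy]
      module)
    rwa [neg_one_smul, add_neg_eq_zero] at h5

theorem exists_of_mem_resolventSet {lam : ℂ}
    (h : lam ∈ unboundedResolventSet (systemOperator K)) (y : StateSpace K) :
    ∃ z, IsSystemPair z (lam • z - y) := by
  obtain ⟨R, h1, -⟩ := h
  obtain ⟨x, -, hx⟩ := h1 y
  refine ⟨x, ?_⟩
  rw [← hx, sub_sub_cancel]
  exact (mem_systemOperator_graph K _).1 ((systemOperator K).mem_graph x)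

theorem eq_zero_of_mem_resolventSet {lam : ℂ}
    (h : lam ∈ unboundedResolventSet (systemOperator K)) {z : StateSpace K}
    (hz : IsSystemPair z (lam • z)) : z = 0 := by
  obtain ⟨R, -, h2⟩ := h
  obtain ⟨x, hx1, hx2⟩ := (LinearPMap.mem_graph_iff _).1
    ((mem_systemOperator_graph K (z, lam • z)).2 hz)
  have h3 := h2 x
  rw [hx2, hx1, sub_self, map_zero] at h3
  exact h3.symm

variable {C δ : ℝ} (hC : 0 ≤ C)
  (hμ : ∀ t s : ℝ, 0 ≤ t → 0 < s → K.μ (t + s) ≤ C * Real.exp (-δ * t) * K.μ s)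
  {lam : ℂ} (hlam : 0 < lam.re + δ / 2)

/-- The contribution `∫_0^∞ μ(s) ((λ - T)⁻¹ ξ)(s) ds` of a memory datum `ξ` to the flux. -/
def memoryFlux : Memory K →L[ℂ] H1r := integralL2 H1r K.measure ∘L memoryResolvent hC hμ hlam

/-- Elimination of the memory variable from the resolvent equation `(λ - 𝔸) z = y`. -/
theorem isSystemPair_iff {z y : StateSpace K} : IsSystemPair z (lam • z - y) ↔
    ∃ w : H1r, z.w = w.toL2 ∧ z.v = (lam • z.u - y.u).toL2 ∧
      z.η = memoryResolvent hC hμ hlam (y.η + Lp.const 2 K.measure w) ∧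
      HasWeakDerivOn (Ioo (-1) 0) z.u.deriv (lam • z.v - y.v : L2 (-1) 0) ∧
      HasWeakDerivOn (Ioo 0 1) (K.ellExt lam • w + memoryFlux hC hμ hlam y.η).deriv
        (lam • z.w - y.w : L2 0 1) ∧
      (∃ c : ℂ, HasTrace (Ioo (-1) 0) z.u.deriv 0 c ∧
        HasTrace (Ioo 0 1) (K.ellExt lam • w + memoryFlux hC hμ hlam y.η).deriv 0 c) ∧
      traceLeft (lam • z.u - y.u) = traceRight w := by
  have key : ∀ w : H1r, flux w (memoryResolvent hC hμ hlam (y.η + Lp.const 2 K.measure w)) =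
      K.ellExt lam • w + memoryFlux hC hμ hlam y.η := by
    intro w
    rw [flux, ← integralL2_apply, map_add, map_add, integral_memoryResolvent_const]
    change w + (memoryFlux hC hμ hlam y.η + _) = _
    module
  have eu : (lam • z - y).u = lam • z.u - y.u := rfl
  have ev : (lam • z - y).v = lam • z.v - y.v := rfl
  have ew : (lam • z - y).w = lam • z.w - y.w := rfl
  have eη : (lam • z - y).η = lam • z.η - y.η := rfl
  constructor
  · rintro ⟨v, w, u'', φ'', t, h1, h2, h3, h4, h5, h6, ⟨c, h7, h7'⟩, h8, h9, h10, h11⟩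
    rw [eu] at h8
    rw [ev] at h9
    rw [ew] at h10
    rw [eη] at h11
    have hη : z.η = memoryResolvent hC hμ hlam (y.η + Lp.const 2 K.measure w) := by
      refine eq_memoryResolvent ?_
      convert h5 using 2
      rw [← sub_sub, h11, add_sub_cancel_right]
    rw [hη, key] at h4 h6
    refine ⟨w, h2.symm, by rw [h8, h1], hη, h9 ▸ h3, h10 ▸ h4, h6, ?_⟩
    rw [h8, HasTrace.eq_left (hasTrace_traceLeft v) h7, HasTrace.eq_right (hasTrace_traceRight w) h7']
  · rintro ⟨w, h1, h2, h3, h4, h5, h6, h7⟩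
    refine ⟨lam • z.u - y.u, w, lam • z.v - y.v, lam • z.w - y.w,
      lam • z.η - (y.η + Lp.const 2 K.measure w), h2.symm, h1.symm, h4, ?_, ?_, ?_,
      ⟨_, hasTrace_traceLeft _, h7 ▸ hasTrace_traceRight w⟩, rfl, rfl, rfl, ?_⟩
    · rwa [h3, key]
    · rw [h3]
      exact memoryResolvent_mem_graph _
    · rwa [h3, key]
    · rw [eη]; abel

/-- For `ℓ(λ) = 0` the flux does not depend on `w`, so that the resolvent equation with datum
`(0,0,1,0)` forces `λ w = 1`, which contradicts `w(1) = 0`. -/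
theorem notMem_resolventSet_of_ellExt_eq_zero {C δ : ℝ} (hC : 0 ≤ C)
    (hμ : ∀ t s : ℝ, 0 ≤ t → 0 < s → K.μ (t + s) ≤ C * Real.exp (-δ * t) * K.μ s)
    {lam : ℂ} (hlam : 0 < lam.re + δ / 2)
    (h0 : K.ellExt lam = 0) :
    lam ∉ unboundedResolventSet (systemOperator K) := by
  intro h
  obtain ⟨z, hz⟩ := exists_of_mem_resolventSet h
    (StateSpace.mk 0 0 (Lp.const 2 (volume.restrict (Ioo 0 1)) (1 : ℂ)) 0)
  obtain ⟨w, h1, -, -, -, h5, -, -⟩ := (isSystemPair_iff hC hμ hlam).1 hz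
  have e1 : (StateSpace.mk 0 0 (Lp.const 2 (volume.restrict (Ioo 0 1)) (1 : ℂ)) 0 :
    StateSpace K).η = 0 := rfl
  have e2 : (StateSpace.mk 0 0 (Lp.const 2 (volume.restrict (Ioo 0 1)) (1 : ℂ)) 0 :
    StateSpace K).w = Lp.const 2 (volume.restrict (Ioo 0 1)) (1 : ℂ) := rfl
  rw [e1, h0, zero_smul, map_zero, add_zero, map_zero] at h5
  have h6 := L2.eq_zero_of_hasWeakDerivOn h5
  rw [e2, sub_eq_zero, h1] at h6
  have h7 := (w.hasTrace.smul lam).congr measurableSet_Ioo (Lp.coeFn_smul lam w.toL2).symm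
  rw [h6, smul_zero] at h7
  have h8 : HasTrace (Ioo 0 1) (fun _ => (1 : ℂ)) 1 0 :=
    h7.congr measurableSet_Ioo (Lp.coeFn_const ..)
  exact zero_ne_one (HasTrace.unique (by norm_num) (by norm_num) h8 tendsto_const_nhds)

/-- The inhomogeneity `F = -g - λ f` in the equation `u'' = λ² u + F` for the datum `(f,g,h,ξ)`. -/
def sourceLeft (lam : ℂ) : StateSpace K →L[ℂ] L2 (-1) 0 :=
  -StateSpace.vL K - lam • H1.toL2L (-1) 0 (-1) ∘L StateSpace.uL K

/-- The inhomogeneity `G = -h - (λ/ℓ) Ψ(ξ)` in the equation `φ'' = (λ/ℓ) φ + G` for the datum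
`(f,g,h,ξ)`. -/
def sourceRight : StateSpace K →L[ℂ] L2 0 1 :=
  -StateSpace.wL K -
    (lam / K.ellExt lam) • H1.toL2L 0 1 1 ∘L memoryFlux hC hμ hlam ∘L StateSpace.ηL K

/-- The component `u` of a solution of the resolvent equation, with parameter `a = u'(-1)`. -/
def solLeft (lam : ℂ) (y : StateSpace K) (a : ℂ) : H1l :=
  H1.generalSol (-1) 0 (-1) lam (sourceLeft lam y) a

/-- The flux of a solution of the resolvent equation, with parameter `c = φ'(1)`. -/
def solFlux (k : ℂ) (y : StateSpace K) (c : ℂ) : H1r :=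
  H1.generalSol 0 1 1 k (sourceRight hC hμ hlam y) c

/-- The component `w` of a solution of the resolvent equation, obtained from `φ = ℓ w + Ψ`. -/
def solRight (k : ℂ) (y : StateSpace K) (c : ℂ) : H1r :=
  (K.ellExt lam)⁻¹ • (solFlux hC hμ hlam k y c - memoryFlux hC hμ hlam y.η)

/-- The solution of the two differential equations in the resolvent equation with free parameters
`a = u'(-1)`, `c = φ'(1)`; the interface conditions remain to be satisfied. -/
def solState (k : ℂ) (y : StateSpace K) (a c : ℂ) : StateSpace K :=
  StateSpace.mk (solLeft lam y a) (lam • solLeft lam y a - y.u).toL2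
    (solRight hC hμ hlam k y c).toL2
    (memoryResolvent hC hμ hlam (y.η + Lp.const 2 K.measure (solRight hC hμ hlam k y c)))

/-- The jump `φ'(0) - u'(0)` of the particular solutions, which the homogeneous solutions have to
compensate. -/
def jumpDeriv (k : ℂ) : StateSpace K →L[ℂ] ℂ :=
  traceRight ∘L H1.solveSecondDeriv 0 1 1 k ∘L sourceRight hC hμ hlam -
    traceLeft ∘L H1.solveSecondDeriv (-1) 0 (-1) lam ∘L sourceLeft lam

/-- The jump `w(0) - v(0)` of the particular solutions, which the homogeneous solutions have to
compensate. -/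
def jumpValue (k : ℂ) : StateSpace K →L[ℂ] ℂ :=
  (K.ellExt lam)⁻¹ • (traceRight ∘L H1.solveSecond 0 1 1 k ∘L sourceRight hC hμ hlam -
      traceRight ∘L memoryFlux hC hμ hlam ∘L StateSpace.ηL K) -
    lam • traceLeft ∘L H1.solveSecond (-1) 0 (-1) lam ∘L sourceLeft lam +
    traceLeft ∘L StateSpace.uL K

/-- The interface conditions for `solState` are a linear system for the free parameters. -/
theorem isSystemPair_solState {k : ℂ} (hl : K.ellExt lam ≠ 0) (hk : k ^ 2 * K.ellExt lam = lam)
    (y : StateSpace K) {a c : ℂ}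
    (h1 : a * Complex.cosh lam - c * Complex.cosh k = jumpDeriv hC hμ hlam k y)
    (h2 : a * Complex.sinh lam + c * ((K.ellExt lam)⁻¹ * sinhDiv k 1) = jumpValue hC hμ hlam k y) :
    IsSystemPair (solState hC hμ hlam k y a c) (lam • solState hC hμ hlam k y a c - y) := by
  have eφ : K.ellExt lam • solRight hC hμ hlam k y c + memoryFlux hC hμ hlam y.η =
      solFlux hC hμ hlam k y c := by
    rw [solRight, smul_inv_smul₀ hl, sub_add_cancel]
  have hk' : k ^ 2 = lam / K.ellExt lam := by rw [eq_div_iff hl, hk]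
  refine (isSystemPair_iff hC hμ hlam).2
    ⟨solRight hC hμ hlam k y c, rfl, rfl, rfl, ?_, ?_, ⟨_, H1.generalSol_deriv_hasTrace _ _ _
      (hasTrace_traceLeft _), ?_⟩, ?_⟩
  · change HasWeakDerivOn _ (H1.generalSol (-1) 0 (-1) lam (sourceLeft lam y) a).deriv
      (lam • (lam • solLeft lam y a - y.u).toL2 - y.v : L2 (-1) 0)
    have e1 : lam • (lam • solLeft lam y a - y.u).toL2 - y.v =
        lam ^ 2 • (solLeft lam y a).toL2 + (-y.v - lam • y.u.toL2) := by
      rw [map_sub, map_smul]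
      module
    rw [e1]
    exact H1.generalSol_deriv_hasWeakDerivOn lam (sourceLeft lam y) a
  · rw [eφ]
    change HasWeakDerivOn _ (H1.generalSol 0 1 1 k (sourceRight hC hμ hlam y) c).deriv
      (lam • (solRight hC hμ hlam k y c).toL2 - y.w : L2 0 1)
    have e1 : lam • (solRight hC hμ hlam k y c).toL2 - y.w =
        k ^ 2 • (solFlux hC hμ hlam k y c).toL2 +
          (-y.w - (lam / K.ellExt lam) • (memoryFlux hC hμ hlam y.η).toL2) := by
      rw [hk', solRight, map_smul, map_sub, smul_smul, ← div_eq_mul_inv]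
      module
    rw [e1]
    exact H1.generalSol_deriv_hasWeakDerivOn k (sourceRight hC hμ hlam y) c
  · rw [eφ]
    change HasTrace _ (H1.generalSol 0 1 1 k (sourceRight hC hμ hlam y) c).deriv 0 _
    convert H1.generalSol_deriv_hasTrace (e := 1) k (sourceRight hC hμ hlam y) c
      (hasTrace_traceRight _) using 1
    have h3 : a * Complex.cosh lam - c * Complex.cosh k =
      traceRight (H1.solveSecondDeriv 0 1 1 k (sourceRight hC hμ hlam y)) -
        traceLeft (H1.solveSecondDeriv (-1) 0 (-1) lam (sourceLeft lam y)) := h1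
    have e1 : Complex.cosh (lam * ((0 - (-1) : ℝ) : ℂ)) = Complex.cosh lam := by simp
    have e2 : Complex.cosh (k * ((0 - 1 : ℝ) : ℂ)) = Complex.cosh k := by simp
    rw [e1, e2]
    linear_combination h3
  · change traceLeft (lam • solLeft lam y a - y.u) = _
    have h3 : a * Complex.sinh lam + c * ((K.ellExt lam)⁻¹ * sinhDiv k 1) =
      (K.ellExt lam)⁻¹ * (traceRight (H1.solveSecond 0 1 1 k (sourceRight hC hμ hlam y)) -
        traceRight (memoryFlux hC hμ hlam y.η)) -
        lam * traceLeft (H1.solveSecond (-1) 0 (-1) lam (sourceLeft lam y)) + traceLeft y.u := h2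
    have h4 := mul_sinhDiv lam 1
    rw [Complex.ofReal_one, mul_one] at h4
    rw [solRight, solFlux, solLeft, H1.generalSol, H1.generalSol]
    simp only [map_add, map_sub, map_smul, traceLeft_sinhElem, traceRight_sinhElem, smul_eq_mul]
    linear_combination h3 + a * h4

/-- Every solution of the homogeneous resolvent equation is of the form `solState` with datum `0`. -/
theorem isSystemPair_eigen {k : ℂ} (hl : K.ellExt lam ≠ 0) (hk : k ^ 2 * K.ellExt lam = lam)
    {z : StateSpace K} (h : IsSystemPair z (lam • z)) :
    ∃ a c : ℂ, z = solState hC hμ hlam k 0 a c ∧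
      a * Complex.cosh lam - c * Complex.cosh k = 0 ∧
      a * Complex.sinh lam + c * ((K.ellExt lam)⁻¹ * sinhDiv k 1) = 0 := by
  rw [← sub_zero (lam • z)] at h
  obtain ⟨w, h1, h2, h3, h4, h5, ⟨d, h6, h6'⟩, h7⟩ := (isSystemPair_iff hC hμ hlam).1 h
  have e0u : (0 : StateSpace K).u = 0 := rfl
  have e0v : (0 : StateSpace K).v = 0 := rfl
  have e0w : (0 : StateSpace K).w = 0 := rfl
  have e0η : (0 : StateSpace K).η = 0 := rfl
  have hk' : k ^ 2 = lam / K.ellExt lam := by rw [eq_div_iff hl, hk]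
  rw [e0u, sub_zero] at h2 h7
  rw [e0v, sub_zero, h2, map_smul, smul_smul, ← sq] at h4
  rw [e0η, map_zero, add_zero] at h5 h6'
  rw [e0w, sub_zero, h1] at h5
  obtain ⟨a, ha⟩ := H1.eq_smul_sinhElem h4
  obtain ⟨c, hc⟩ := H1.eq_smul_sinhElem (k := k) (f := K.ellExt lam • w) (by
    convert h5 using 2
    rw [map_smul, smul_smul, hk])
  have hu : z.u = solLeft lam (0 : StateSpace K) a := by
    rw [ha, solLeft, H1.generalSol, map_zero, map_zero, zero_add]
  have hφ : K.ellExt lam • w = solFlux hC hμ hlam k (0 : StateSpace K) c := by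
    rw [hc, solFlux, H1.generalSol, map_zero, map_zero, zero_add]
  have hw : w = solRight hC hμ hlam k (0 : StateSpace K) c := by
    rw [solRight, e0η, map_zero, sub_zero, ← hφ, inv_smul_smul₀ hl]
  refine ⟨a, c, StateSpace.ext hu ?_ ?_ ?_, ?_, ?_⟩
  · rw [h2, hu]
    change _ = (lam • solLeft lam (0 : StateSpace K) a - 0).toL2
    rw [sub_zero]
  · rw [h1, hw]; rfl
  · rw [h3, hw]; rfl
  · rw [hu] at h6
    rw [hφ] at h6'
    have h8 := HasTrace.eq_left h6 (H1.generalSol_deriv_hasTrace _ _ _ (hasTrace_traceLeft _))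
    have h9 := HasTrace.eq_right h6' (H1.generalSol_deriv_hasTrace _ _ _ (hasTrace_traceRight _))
    simp only [map_zero, zero_add] at h8 h9
    rw [h8] at h9
    have e1 : Complex.cosh (lam * ((0 - (-1) : ℝ) : ℂ)) = Complex.cosh lam := by simp
    have e2 : Complex.cosh (k * ((0 - 1 : ℝ) : ℂ)) = Complex.cosh k := by simp
    rw [e1, e2] at h9
    rw [h9, sub_self]
  · have hw' : w = (K.ellExt lam)⁻¹ • c • H1.sinhElem 0 1 1 k := by rw [← hc, inv_smul_smul₀ hl]
    have h4 := mul_sinhDiv lam 1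
    rw [Complex.ofReal_one, mul_one] at h4
    rw [ha, hw'] at h7
    simp only [map_smul, traceLeft_sinhElem, traceRight_sinhElem, smul_eq_mul] at h7
    linear_combination h7 - a * h4

theorem solState_zero_eq_zero {k : ℂ} (hl : K.ellExt lam ≠ 0) {a c : ℂ}
    (h : solState hC hμ hlam k (0 : StateSpace K) a c = 0) : a = 0 ∧ c = 0 := by
  constructor
  · have h1 : solLeft lam (0 : StateSpace K) a = 0 := congrArg StateSpace.u h
    rw [solLeft, H1.generalSol, map_zero, map_zero, zero_add] at h1
    exact (smul_eq_zero.1 h1).resolve_right (H1.sinhElem_ne_zero _)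
  · have h1 : (solRight hC hμ hlam k (0 : StateSpace K) c).toL2 = 0 := congrArg StateSpace.w h
    have h2 := H1.toL2_injective h1
    have e0η : (0 : StateSpace K).η = 0 := rfl
    rw [solRight, solFlux, H1.generalSol, map_zero, map_zero, zero_add, e0η, map_zero, sub_zero] at h2
    exact (smul_eq_zero.1 ((smul_eq_zero.1 h2).resolve_left (inv_ne_zero hl))).resolve_right
      (H1.sinhElem_ne_zero _)

theorem notMem_resolventSet_of_det_eq_zero {C δ : ℝ} (hC : 0 ≤ C)
    (hμ : ∀ t s : ℝ, 0 ≤ t → 0 < s → K.μ (t + s) ≤ C * Real.exp (-δ * t) * K.μ s)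
    {lam : ℂ} (hlam : 0 < lam.re + δ / 2)
    {k : ℂ} (hl : K.ellExt lam ≠ 0)
    (hk : k ^ 2 * K.ellExt lam = lam)
    (h0 : Complex.cosh lam * ((K.ellExt lam)⁻¹ * sinhDiv k 1) +
      Complex.sinh lam * Complex.cosh k = 0) :
    lam ∉ unboundedResolventSet (systemOperator K) := by
  intro h
  have key : ∀ a c : ℂ, a * Complex.cosh lam - c * Complex.cosh k = 0 →
      a * Complex.sinh lam + c * ((K.ellExt lam)⁻¹ * sinhDiv k 1) = 0 → a = 0 ∧ c = 0 := by
    intro a c h1 h2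
    have h3 := isSystemPair_solState hC hμ hlam hl hk 0 (a := a) (c := c)
      (by rw [h1, map_zero]) (by rw [h2, map_zero])
    rw [sub_zero] at h3
    exact solState_zero_eq_zero hC hμ hlam hl (eq_zero_of_mem_resolventSet h h3)
  -- the columns of the adjugate matrix (up to sign) lie in the kernel of the singular system, and
  -- `cosh λ`, `sinh λ` do not both vanish
  have h1 := (key (Complex.cosh k) (Complex.cosh lam) (by ring) (by linear_combination h0)).2
  have h2 := (key (-((K.ellExt lam)⁻¹ * sinhDiv k 1)) (Complex.sinh lam)
    (by linear_combination -h0) (by ring)).2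
  have h3 := Complex.cosh_sq_sub_sinh_sq lam
  rw [h1, h2] at h3
  norm_num at h3

theorem mem_resolventSet_of_det_ne_zero {C δ : ℝ} (hC : 0 ≤ C)
    (hμ : ∀ t s : ℝ, 0 ≤ t → 0 < s → K.μ (t + s) ≤ C * Real.exp (-δ * t) * K.μ s)
    {lam : ℂ} (hlam : 0 < lam.re + δ / 2)
    {k : ℂ} (hl : K.ellExt lam ≠ 0)
    (hk : k ^ 2 * K.ellExt lam = lam)
    (h0 : Complex.cosh lam * ((K.ellExt lam)⁻¹ * sinhDiv k 1) +
      Complex.sinh lam * Complex.cosh k ≠ 0) :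
    lam ∈ unboundedResolventSet (systemOperator K) := by
  set D := Complex.cosh lam * ((K.ellExt lam)⁻¹ * sinhDiv k 1) +
    Complex.sinh lam * Complex.cosh k with hD
  set p := jumpDeriv hC hμ hlam k with hp
  set q := jumpValue hC hμ hlam k with hq
  -- Cramer's rule for the interface conditions
  let a : StateSpace K →L[ℂ] ℂ :=
    D⁻¹ • (((K.ellExt lam)⁻¹ * sinhDiv k 1) • p + Complex.cosh k • q)
  let c : StateSpace K →L[ℂ] ℂ := D⁻¹ • (Complex.cosh lam • q - Complex.sinh lam • p)
  have ha : ∀ y, a y = D⁻¹ * (((K.ellExt lam)⁻¹ * sinhDiv k 1) * p y + Complex.cosh k * q y) :=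
    fun y => rfl
  have hc : ∀ y, c y = D⁻¹ * (Complex.cosh lam * q y - Complex.sinh lam * p y) := fun y => rfl
  let u : StateSpace K →L[ℂ] H1l := H1.solveSecond (-1) 0 (-1) lam ∘L sourceLeft lam +
    a.smulRight (H1.sinhElem (-1) 0 (-1) lam)
  let w : StateSpace K →L[ℂ] H1r := (K.ellExt lam)⁻¹ •
    ((H1.solveSecond 0 1 1 k ∘L sourceRight hC hμ hlam + c.smulRight (H1.sinhElem 0 1 1 k)) -
      memoryFlux hC hμ hlam ∘L StateSpace.ηL K)
  let R : StateSpace K →L[ℂ] StateSpace K := StateSpace.mkL u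
    (H1.toL2L (-1) 0 (-1) ∘L (lam • u - StateSpace.uL K)) (H1.toL2L 0 1 1 ∘L w)
    (memoryResolvent hC hμ hlam ∘L (StateSpace.ηL K + Lp.constL 2 K.measure ℂ ∘L w))
  have hR : ∀ y, R y = solState hC hμ hlam k y (a y) (c y) := fun y => rfl
  refine mem_resolventSet_systemOperator R (fun y => ?_) fun z hz => ?_
  · rw [hR]
    refine isSystemPair_solState hC hμ hlam hl hk y ?_ ?_
    · rw [ha, hc, ← hp]
      linear_combination p y * inv_mul_cancel₀ h0 - D⁻¹ * p y * hD
    · rw [ha, hc, ← hq]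
      linear_combination q y * inv_mul_cancel₀ h0 - D⁻¹ * q y * hD
  · obtain ⟨a', c', rfl, h1, h2⟩ := isSystemPair_eigen hC hμ hlam hl hk hz
    have ea : D * a' = 0 := by
      rw [hD]
      linear_combination ((K.ellExt lam)⁻¹ * sinhDiv k 1) * h1 + Complex.cosh k * h2
    have ec : D * c' = 0 := by
      rw [hD]
      linear_combination Complex.cosh lam * h2 - Complex.sinh lam * h1
    rw [(mul_eq_zero.1 ea).resolve_left h0, (mul_eq_zero.1 ec).resolve_left h0]
    have h3 := hR 0
    rw [map_zero, map_zero, map_zero] at h3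
    exact h3.symm

end ResolventEquation

end

/-! ### The spectrum in the strip -/

theorem theoremA1 (K : MemoryKernel) (C δ : ℝ) (hC : 1 ≤ C) (hδ : 0 < δ)
    (hμ : ∀ t s : ℝ, 0 ≤ t → 0 < s → K.μ (t + s) ≤ C * Real.exp (-δ * t) * K.μ s) :
    unboundedSpectrum (systemOperator K) ∩ strip δ = K.sigmaSet δ ∪ K.zeroSet δ := by
  have hC0 : 0 ≤ C := zero_le_one.trans hC
  ext lam
  by_cases hs : lam ∈ strip δ
  swap
  · exact ⟨fun h => absurd h.2 hs, fun h => absurd (h.elim (fun h => h.1) fun h => h.1) hs⟩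
  have hlam : 0 < lam.re + δ / 2 := by
    have := hs.1
    linarith
  by_cases h0 : lam = 0
  · -- the determinant of the interface conditions at `λ = 0`, where `ℓ` is replaced by `2`
    have hres : lam ∈ unboundedResolventSet (systemOperator K) := by
      refine mem_resolventSet_of_det_ne_zero hC0 hμ hlam (k := 0) ?_ ?_ ?_
      · rw [h0, K.ellExt_zero]
        norm_num
      · rw [h0]
        norm_num
      · rw [h0, K.ellExt_zero]
        norm_num [sinhDiv]
    exact ⟨fun h => absurd hres h.1, fun h => absurd h0 (h.elim (fun h => h.2.1) fun h => h.2.1)⟩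
  have hell := K.ellExt_of_ne_zero h0
  by_cases hl : K.ell lam = 0
  · exact ⟨fun _ => Or.inr ⟨hs, h0, hl⟩,
      fun _ => ⟨notMem_resolventSet_of_ellExt_eq_zero hC0 hμ hlam (hell.trans hl), hs⟩⟩
  set k := principalSqrt (lam / K.ell lam) with hk
  have hk2 : k ^ 2 * K.ell lam = lam := by rw [hk, principalSqrt_sq, div_mul_cancel₀ _ hl]
  have hk0 : k ≠ 0 := by
    rintro h
    rw [h] at hk2
    exact h0 (by rw [← hk2]; ring)
  -- the characteristic function is `k ℓ` times the determinant of the interface conditions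
  have hdet : K.ell lam * k * Complex.sinh lam * Complex.cosh k +
      Complex.cosh lam * Complex.sinh k = K.ell lam * k *
        (Complex.cosh lam * ((K.ell lam)⁻¹ * sinhDiv k 1) + Complex.sinh lam * Complex.cosh k) := by
    have h1 := mul_sinhDiv k 1
    rw [Complex.ofReal_one, mul_one] at h1
    rw [← h1]
    field_simp
    ring
  have hl' : K.ellExt lam ≠ 0 := hell ▸ hl
  have hk' : k ^ 2 * K.ellExt lam = lam := hell ▸ hk2
  constructor
  · rintro ⟨h, -⟩
    refine Or.inl ⟨hs, h0, hl, ?_⟩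
    by_contra hne
    rw [← hk, hdet] at hne
    exact h (mem_resolventSet_of_det_ne_zero hC0 hμ hlam hl' hk'
      (hell.symm ▸ right_ne_zero_of_mul hne))
  · rintro (h | h)
    · have h1 := h.2.2.2
      rw [← hk, hdet] at h1
      exact ⟨notMem_resolventSet_of_det_eq_zero hC0 hμ hlam hl' hk'
        (hell.symm ▸ (mul_eq_zero.1 h1).resolve_left (mul_ne_zero hl hk0)), hs⟩
    · exact absurd h.2.2 hl
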